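/- Let $C$ be an infinite, totally and densely ordered set of constants (such as $\mathbb Q$ or $\mathbb R$). A conjunctive query with arithmetic comparisons (CQAC) consists of a head (a tuple of variables and constants) and a body, which is a finite set of relational atoms over variables and constants together with finitely many comparisons $X\,\theta\,Y$, where $\theta\in\{<,>,\le,\ge,=,\neq\}$, $X$ is a variable and $Y$ is a variable or a constant. All variables of the head and of the comparisons occur in relational atoms of the body, and the comparisons are jointly satisfiable in $C$. For a database (finite set of facts) $D$, the answer $Q(D)$ is the set of images of the head under all assignments of variables to constants that map the relational atoms into $D$ and make the comparisons true. A CQAC is RSI1 with closed comparisons if each of its comparisons has the form $X\le c$ or $X\ge c$ with a constant $c$, and only one of them has the form $X\ge c$. For a finite set $\mathcal V$ of views, each defined by a CQAC, let $\mathcal V(D)$ be the set of view facts obtained by evaluating all view definitions on $D$. A view instance is a finite set $\mathcal I$ of view facts such that $\mathcal I\subseteq\mathcal V(D)$ for some database $D$. The certain answers of $Q$ on $\mathcal I$ (under the open world assumption) are $$\mathrm{certain}(Q,\mathcal I)=\bigcap\{Q(D) : D \text{ a database with } \mathcal I\subseteq\mathcal V(D)\}.$$ **Theorem.** Let $Q$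 be a query that is RSI1 with closed comparisons and let $\mathcal V$ be a finite set of CQAC views. Then there is an algorithm that, given any view instance $\mathcal I$, computes $\mathrm{certain}(Q,\mathcal I)$ in time polynomial in the size of $\mathcal I$. (Here $Q$ and $\mathcal V$ are fixed; the algorithm and the polynomial may depend on them.) Time is measured on while programs over finite binary trees with constants at the leaves, which can take trees apart, put them together, copy them, and compare two constants with respect to the order; each instruction is charged one unit plus the sizes of all the trees that it copies, takes apart, puts together or compares (a test whether a tree is a leaf costs one unit), and writing a constant is charged its length. The size of a tree counts its nodes and the lengths of its constants, for an arbitrary given length function $C\to\mathbb N$; the size of $\mathcal I$ is the size of a listing of $\mathcal I$ as a tree. The length function is fixed beforehand as well. -/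

import Mathlib

namespace CertainAnswers

universe u v

/-! Conjunctive queries with arithmetic comparisons over an ordered domain `C` of constants.
`R` is the type of relation symbols; variables are natural numbers. -/

/-- A term: a variable or a constant. -/
inductive Term (C : Type u) where
  | var (x : ℕ)
  | const (c : C)

/-- The value of a term under an assignment of the variables. -/
def Term.eval {C : Type u} (h : ℕ → C) : Term C → C
  | .var x => h x
  | .const c => c

/-- A relational atom. A symbol used with two different numbers of arguments denotes two different
relations, so every database schema is covered. -/
structure Atom (R : Type v) (C : Type u) where
  rel : R
  args : List (Term C)

/-- A fact: a symbol (of a base relation, or of a view) with a tuple of constants. -/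
abbrev Fact (R : Type v) (C : Type u) := R × List C

/-- A database instance: a finite set of facts. -/
abbrev Database (R : Type v) (C : Type u) := Finset (Fact R C)

/-- The instance of an atom under an assignment of the variables. -/
def Atom.inst {R : Type v} {C : Type u} (h : ℕ → C) (a : Atom R C) : Fact R C :=
  (a.rel, a.args.map (Term.eval h))

/-- The comparison symbols. -/
inductive Cmp where
  | lt | gt | le | ge | eq | ne

/-- The relation denoted by a comparison symbol. -/
def Cmp.Holds {C : Type u} [LinearOrder C] : Cmp → C → C → Prop
  | .lt, a, b => a < b
  | .gt, a, b => a > b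
  | .le, a, b => a ≤ b
  | .ge, a, b => a ≥ b
  | .eq, a, b => a = b
  | .ne, a, b => a ≠ b

/-- An arithmetic comparison `X θ Y`: `X` is a variable, `Y` a variable or a constant. -/
structure AC (C : Type u) where
  lhs : ℕ
  cmp : Cmp
  rhs : Term C

/-- The truth of a comparison under an assignment of the variables. -/
def AC.Holds {C : Type u} [LinearOrder C] (h : ℕ → C) (b : AC C) : Prop :=
  b.cmp.Holds (h b.lhs) (b.rhs.eval h)

/-- A conjunctive query with arithmetic comparisons (CQAC). -/
structure CQAC (R : Type v) (C : Type u) [LinearOrder C] where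
  head : List (Term C)
  body : List (Atom R C)
  acs : List (AC C)
  /-- every variable of the head occurs in a relational subgoal -/
  head_safe : ∀ x, Term.var x ∈ head → ∃ a ∈ body, Term.var x ∈ a.args
  /-- every variable of a comparison occurs in a relational subgoal -/
  ac_safe : ∀ b ∈ acs, ∀ x, (x = b.lhs ∨ Term.var x = b.rhs) →
    ∃ a ∈ body, Term.var x ∈ a.args
  /-- the comparisons are not contradictory -/
  consistent : ∃ h : ℕ → C, ∀ b ∈ acs, b.Holds h

/-- The result `Q(D)`: the tuples produced by the assignments that send every relational subgoal
to a fact of `D` and make all comparisons true. -/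
def CQAC.answers {R : Type v} {C : Type u} [LinearOrder C] (Q : CQAC R C) (D : Database R C) :
    Set (List C) :=
  {t | ∃ h : ℕ → C, (∀ a ∈ Q.body, a.inst h ∈ D) ∧ (∀ b ∈ Q.acs, b.Holds h) ∧
    t = Q.head.map (Term.eval h)}

/-- A closed left semi-interval comparison `X ≤ c`. -/
def AC.IsClosedLSI {C : Type u} (b : AC C) : Prop := b.cmp = .le ∧ ∃ c, b.rhs = .const c

/-- A closed right semi-interval comparison `X ≥ c`. -/
def AC.IsClosedRSI {C : Type u} (b : AC C) : Prop := b.cmp = .ge ∧ ∃ c, b.rhs = .const c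

/-- RSI1 with closed comparisons: all comparisons are closed semi-interval ones, and only one of
them is a right semi-interval comparison. -/
def CQAC.IsClosedRSI1 {R : Type v} {C : Type u} [LinearOrder C] (Q : CQAC R C) : Prop :=
  (∀ b ∈ Q.acs, b.IsClosedLSI ∨ b.IsClosedRSI) ∧
  (∀ b ∈ Q.acs, ∀ b' ∈ Q.acs, b.IsClosedRSI → b'.IsClosedRSI → b = b')

/-- The output `𝒱(D)` of all view definitions on `D`. The views are named by `Fin n`. -/
def viewOutput {R : Type v} {C : Type u} [LinearOrder C] {n : ℕ} (V : Fin n → CQAC R C)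
    (D : Database R C) : Set (Fact (Fin n) C) :=
  {f | f.2 ∈ (V f.1).answers D}

/-- `certain(Q, ℐ)` with respect to `𝒱` under the open world assumption: the intersection of all
`Q(D)` with `ℐ ⊆ 𝒱(D)`. It is meaningful only if such a `D` exists. -/
def certain {R : Type v} {C : Type u} [LinearOrder C] {n : ℕ} (Q : CQAC R C)
    (V : Fin n → CQAC R C) (I : Set (Fact (Fin n) C)) : Set (List C) :=
  ⋂ (D : Database R C) (_ : I ⊆ viewOutput V D), Q.answers D

/-! The machine model: while programs over finite binary trees whose leaves may carry constants.
Constants can be copied and compared, nothing else. Every instruction is charged the size of all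
values that it reads. Here `len c` is the length of the constant `c` when it is written down. -/

/-- Binary trees with leaves that are empty or carry a constant. -/
inductive Tree (C : Type u) where
  | nil
  | atom (c : C)
  | cons (l r : Tree C)

/-- The size of a tree. -/
def Tree.size {C : Type u} (len : C → ℕ) : Tree C → ℕ
  | .nil => 1
  | .atom c => 1 + len c
  | .cons l r => 1 + l.size len + r.size len

/-- The left subtree (`nil` if there is none). -/
def Tree.left {C : Type u} : Tree C → Tree C
  | .cons l _ => l
  | _ => .nil

/-- The right subtree (`nil` if there is none). -/
def Tree.right {C : Type u} : Tree C → Tree C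
  | .cons _ r => r
  | _ => .nil

/-- The tree has two subtrees. -/
def Tree.IsCons {C : Type u} (t : Tree C) : Prop := ∃ l r, t = .cons l r

/-- Both trees are leaves that carry constants, and the first constant is at most the second. -/
def Tree.AtomLe {C : Type u} [LinearOrder C] (s t : Tree C) : Prop :=
  ∃ a b, s = .atom a ∧ t = .atom b ∧ a ≤ b

/-- Programs. The registers are numbered by `ℕ` and hold trees; the first register named is the
one that is assigned. -/
inductive Prog (C : Type u) where
  | skip
  | setNil (x : ℕ)
  | setAtom (x : ℕ) (c : C)
  | copy (x y : ℕ)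
  | cons (x y z : ℕ)
  | left (x y : ℕ)
  | right (x y : ℕ)
  | seq (p q : Prog C)
  | ifCons (x : ℕ) (p q : Prog C)
  | ifLe (x y : ℕ) (p q : Prog C)
  | whileCons (x : ℕ) (p : Prog C)

/-- The contents of the registers. -/
abbrev Store (C : Type u) := ℕ → Tree C

/-- `Exec len p s T s'`: started on the registers `s`, the program `p` halts after time exactly `T`
with the registers `s'`. -/
inductive Exec {C : Type u} [LinearOrder C] (len : C → ℕ) :
    Prog C → Store C → ℕ → Store C → Prop where
  | skip (s) : Exec len .skip s 1 s
  | setNil (x s) : Exec len (.setNil x) s 1 (Function.update s x .nil)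
  | setAtom (x c s) : Exec len (.setAtom x c) s (1 + len c) (Function.update s x (.atom c))
  | copy (x y s) : Exec len (.copy x y) s (1 + (s y).size len) (Function.update s x (s y))
  | cons (x y z s) : Exec len (.cons x y z) s (1 + (s y).size len + (s z).size len)
      (Function.update s x (.cons (s y) (s z)))
  | left (x y s) : Exec len (.left x y) s (1 + (s y).size len)
      (Function.update s x (s y).left)
  | right (x y s) : Exec len (.right x y) s (1 + (s y).size len)
      (Function.update s x (s y).right)
  | seq {p q s s₁ s₂ T₁ T₂} : Exec len p s T₁ s₁ → Exec len q s₁ T₂ s₂ →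
      Exec len (.seq p q) s (T₁ + T₂) s₂
  | ifCons_pos {x p q s s₁ T} : (s x).IsCons → Exec len p s T s₁ →
      Exec len (.ifCons x p q) s (1 + T) s₁
  | ifCons_neg {x p q s s₁ T} : ¬ (s x).IsCons → Exec len q s T s₁ →
      Exec len (.ifCons x p q) s (1 + T) s₁
  | ifLe_pos {x y p q s s₁ T} : (s x).AtomLe (s y) → Exec len p s T s₁ →
      Exec len (.ifLe x y p q) s (1 + (s x).size len + (s y).size len + T) s₁
  | ifLe_neg {x y p q s s₁ T} : ¬ (s x).AtomLe (s y) → Exec len q s T s₁ →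
      Exec len (.ifLe x y p q) s (1 + (s x).size len + (s y).size len + T) s₁
  | while_stop {x p s} : ¬ (s x).IsCons → Exec len (.whileCons x p) s 1 s
  | while_step {x p s s₁ s₂ T₁ T₂} : (s x).IsCons → Exec len p s T₁ s₁ →
      Exec len (.whileCons x p) s₁ T₂ s₂ → Exec len (.whileCons x p) s (1 + T₁ + T₂) s₂

/-- `p` halts on input `i` (in register `0`, all other registers being `nil`) after time `T` with
output `o` (in register `0`). -/
def Computes {C : Type u} [LinearOrder C] (len : C → ℕ) (p : Prog C) (i o : Tree C) (T : ℕ) :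
    Prop :=
  ∃ s : Store C, Exec len p (Function.update (fun _ => .nil) 0 i) T s ∧ s 0 = o

/-- A list of trees written as a tree. -/
def encodeList {C : Type u} : List (Tree C) → Tree C
  | [] => .nil
  | t :: ts => .cons t (encodeList ts)

/-- A tuple of constants written as a tree. -/
def encodeTuple {C : Type u} (t : List C) : Tree C := encodeList (t.map .atom)

/-- A view fact written as a tree: the number of the view, then the tuple. -/
def encodeFact {C : Type u} {n : ℕ} (f : Fact (Fin n) C) : Tree C :=
  .cons (encodeList (List.replicate f.1 .nil)) (encodeTuple f.2)

/-- A listing of a view instance written as a tree. -/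
def encodeInstance {C : Type u} {n : ℕ} (L : List (Fact (Fin n) C)) : Tree C :=
  encodeList (L.map encodeFact)

/-- A listing of answer tuples written as a tree. -/
def encodeAnswers {C : Type u} (A : List (List C)) : Tree C := encodeList (A.map encodeTuple)

end CertainAnswers

/-!
Unfold every view fact `f` of the instance along an assignment `H f` of the variables of its view.
By monotonicity, `t` is a certain answer if and only if `Q` returns `t` on the canonical database
of every such `H` (`mem_certain_iff`). An adversary who wants to avoid `t` prefers large values,
because of the comparisons `X ≤ c`, but is tempted to make some values small, because of the single
comparison `X₀ ≥ c₀`. A match of the query that cannot be avoided otherwise forces the value at the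
image of `X₀` below `c₀`. Since there is only one lower bound, each match forces just one such
literal "the value of the term `p` in the unfolding of `f` is less than `c₀`": the constraints are
Horn, and the forced literals form a least fixpoint (`Derives`, `deriveStep`). The tuple `t` is
certain if and only if it follows from these literals (`derives_iff_mem_certain`).

For completeness, a refuting unfolding has to be found if `t` does not follow. Two unfoldings `G`,
`H` merge into the one with values `(max a b, a, b)`, ordered lexicographically and embedded into
the dense order `C` with the relevant constants fixed (`exists_merge`, `exists_strictMonoOn_extend`).
It satisfies all comparisons that both satisfy, and every equality or upper bound that fails in one
of them fails in it. Hence, among the unfoldings that make the derived literals true, there is a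
generic one, in which only those equalities and upper bounds hold that hold in all
(`Sat.exists_generic`). A match of the query in it would be unavoidable up to the lower bound, so its
literal would have been derived, and the lower bound would fail (`exists_not_ans`). The upper bounds
have to be closed here: the failure `c < X` of `X ≤ c` survives a merge, while `c ≤ X` need not.

A derivation step inspects boundedly many facts and literals, and its correctness depends only on
the order of the constants involved (`Entails.map`), so a fixed decision tree checks it
(`exists_decision`). The literals about an instance are linear in number, and the rest is bounded
nesting of loops over lists, which the class `PolyTime` of functions on trees is shown to contain
(`PolyTime.foldl`, `PolyTime.flatMap`, `PolyTime.exists_tuples`, `PolyTime.iterate`). Candidates for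
answers are the tuples over the constants of the instance, the query, the views, and the endpoints
of `C` (`mem_of_mem_certain`).
-/

namespace CertainAnswers

universe u v w

section

variable {C : Type u}

/-! ### Polynomial time on trees -/

theorem eval_mono (P : Polynomial ℕ) {a b : ℕ} (h : a ≤ b) : P.eval a ≤ P.eval b := by
  simp only [Polynomial.eval_eq_sum_range]
  gcongr

/-- The program with the registers renumbered by `ρ`. -/
def Prog.rename (ρ : ℕ → ℕ) : Prog C → Prog C
  | .skip => .skip
  | .setNil x => .setNil (ρ x)
  | .setAtom x c => .setAtom (ρ x) c
  | .copy x y => .copy (ρ x) (ρ y)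
  | .cons x y z => .cons (ρ x) (ρ y) (ρ z)
  | .left x y => .left (ρ x) (ρ y)
  | .right x y => .right (ρ x) (ρ y)
  | .seq p q => .seq (p.rename ρ) (q.rename ρ)
  | .ifCons x p q => .ifCons (ρ x) (p.rename ρ) (q.rename ρ)
  | .ifLe x y p q => .ifLe (ρ x) (ρ y) (p.rename ρ) (q.rename ρ)
  | .whileCons x p => .whileCons (ρ x) (p.rename ρ)

theorem update_rename {α : Type*} {ρ : ℕ → ℕ} (hρ : Function.Injective ρ) {s s₁ : ℕ → α}
    (h : ∀ x, s₁ (ρ x) = s x) (x : ℕ) (t : α) :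
    (∀ y, Function.update s₁ (ρ x) t (ρ y) = Function.update s x t y) ∧
      ∀ y ∉ Set.range ρ, Function.update s₁ (ρ x) t y = s₁ y := by
  constructor
  · intro y
    simp only [Function.update_apply, hρ.eq_iff, h]
  · intro y hy
    rw [Function.update_of_ne]
    rintro rfl
    exact hy ⟨x, rfl⟩

variable {len : C → ℕ}

theorem Tree.one_le_size (t : Tree C) : 1 ≤ t.size len := by
  cases t <;> simp only [Tree.size] <;> omega

theorem Tree.size_left_le (t : Tree C) : t.left.size len ≤ t.size len := by
  cases t <;> simp [Tree.size, Tree.left] ; omega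

theorem Tree.size_right_le (t : Tree C) : t.right.size len ≤ t.size len := by
  cases t <;> simp [Tree.size, Tree.right]

theorem size_update_le {s : Store C} {x : ℕ} {t : Tree C} {T : ℕ} (h : t.size len ≤ T) (y : ℕ) :
    (Function.update s x t y).size len ≤ (s y).size len + T := by
  rw [Function.update_apply]
  split_ifs <;> omega

/-- The tree that stands for a truth value. -/
def Tree.ofBool : Bool → Tree C
  | true => .cons .nil .nil
  | false => .nil

@[simp] theorem Tree.isCons_ofBool (b : Bool) : (Tree.ofBool b : Tree C).IsCons ↔ b = true := by
  cases b <;> simp [Tree.ofBool, Tree.IsCons]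

variable [LinearOrder C]

/-- A renumbered program performs the same run on the renumbered registers and leaves all others
alone. -/
theorem Exec.rename {ρ : ℕ → ℕ} (hρ : Function.Injective ρ) {p : Prog C} {s s' : Store C} {T : ℕ}
    (h : Exec len p s T s') : ∀ s₁ : Store C, (∀ x, s₁ (ρ x) = s x) →
    ∃ s₁' : Store C, Exec len (p.rename ρ) s₁ T s₁' ∧ (∀ x, s₁' (ρ x) = s' x) ∧
      ∀ y ∉ Set.range ρ, s₁' y = s₁ y := by
  induction h with
  | skip s => exact fun s₁ h => ⟨s₁, .skip _, h, fun _ _ => rfl⟩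
  | setNil x s => exact fun s₁ h => ⟨_, .setNil _ _, update_rename hρ h _ _⟩
  | setAtom x c s => exact fun s₁ h => ⟨_, .setAtom _ _ _, update_rename hρ h _ _⟩
  | copy x y s =>
    intro s₁ h
    have := Exec.copy (len := len) (ρ x) (ρ y) s₁
    rw [h] at this
    exact ⟨_, this, update_rename hρ h _ _⟩
  | cons x y z s =>
    intro s₁ h
    have := Exec.cons (len := len) (ρ x) (ρ y) (ρ z) s₁
    rw [h, h] at this
    exact ⟨_, this, update_rename hρ h _ _⟩
  | left x y s =>
    intro s₁ h
    have := Exec.left (len := len) (ρ x) (ρ y) s₁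
    rw [h] at this
    exact ⟨_, this, update_rename hρ h _ _⟩
  | right x y s =>
    intro s₁ h
    have := Exec.right (len := len) (ρ x) (ρ y) s₁
    rw [h] at this
    exact ⟨_, this, update_rename hρ h _ _⟩
  | seq _ _ ih₁ ih₂ =>
    intro s₁ h
    obtain ⟨s₂, e₂, h₂, k₂⟩ := ih₁ s₁ h
    obtain ⟨s₃, e₃, h₃, k₃⟩ := ih₂ s₂ h₂
    exact ⟨s₃, .seq e₂ e₃, h₃, fun y hy => (k₃ y hy).trans (k₂ y hy)⟩
  | ifCons_pos hc _ ih =>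
    intro s₁ h
    obtain ⟨s₂, e₂, h₂⟩ := ih s₁ h
    exact ⟨s₂, .ifCons_pos (by rwa [h]) e₂, h₂⟩
  | ifCons_neg hc _ ih =>
    intro s₁ h
    obtain ⟨s₂, e₂, h₂⟩ := ih s₁ h
    exact ⟨s₂, .ifCons_neg (by rwa [h]) e₂, h₂⟩
  | @ifLe_pos x y _ _ s _ _ hc _ ih =>
    intro s₁ h
    obtain ⟨s₂, e₂, h₂⟩ := ih s₁ h
    refine ⟨s₂, ?_, h₂⟩
    rw [← h x, ← h y]
    exact .ifLe_pos (by rwa [h, h]) e₂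
  | @ifLe_neg x y _ _ s _ _ hc _ ih =>
    intro s₁ h
    obtain ⟨s₂, e₂, h₂⟩ := ih s₁ h
    refine ⟨s₂, ?_, h₂⟩
    rw [← h x, ← h y]
    exact .ifLe_neg (by rwa [h, h]) e₂
  | while_stop hc => exact fun s₁ h => ⟨s₁, Exec.while_stop (by rwa [h]), h, fun _ _ => rfl⟩
  | while_step hc _ _ ih₁ ih₂ =>
    intro s₁ h
    obtain ⟨s₂, e₂, h₂, k₂⟩ := ih₁ s₁ h
    obtain ⟨s₃, e₃, h₃, k₃⟩ := ih₂ s₂ h₂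
    exact ⟨s₃, .while_step (by rwa [h]) e₂ e₃, h₃, fun y hy => (k₃ y hy).trans (k₂ y hy)⟩

/-- What a program writes is paid for. -/
theorem Exec.size_le {p : Prog C} {s s' : Store C} {T : ℕ} (h : Exec len p s T s') :
    ∀ x, (s' x).size len ≤ (s x).size len + T := by
  induction h with
  | skip s => intro; omega
  | setNil x s => exact size_update_le (by simp [Tree.size])
  | setAtom x c s => exact size_update_le (by simp [Tree.size])
  | copy x y s => exact size_update_le (by omega)
  | cons x y z s => exact size_update_le (by simp [Tree.size])
  | left x y s => exact size_update_le (by have := Tree.size_left_le (len := len) (s y); omega)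
  | right x y s => exact size_update_le (by have := Tree.size_right_le (len := len) (s y); omega)
  | seq _ _ ih₁ ih₂ => intro x; have := ih₁ x; have := ih₂ x; omega
  | ifCons_pos _ _ ih => intro x; have := ih x; omega
  | ifCons_neg _ _ ih => intro x; have := ih x; omega
  | ifLe_pos _ _ ih => intro x; have := ih x; omega
  | ifLe_neg _ _ ih => intro x; have := ih x; omega
  | while_stop => intro; omega
  | while_step _ _ _ ih₁ ih₂ => intro x; have := ih₁ x; have := ih₂ x; omega

variable (len) in
/-- The function `f` is computed in polynomial time by a program that reads its argument from
register `0` and leaves the value there. The other registers may hold anything at the start, so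
that programs can be composed. -/
def PolyTime (f : Tree C → Tree C) : Prop :=
  ∃ (p : Prog C) (P : Polynomial ℕ), ∀ s : Store C, ∃ (T : ℕ) (s' : Store C),
    Exec len p s T s' ∧ s' 0 = f (s 0) ∧ T ≤ P.eval ((s 0).size len)

namespace PolyTime

variable {f g h : Tree C → Tree C}

/-- A polynomial-time function as a subroutine on the registers from `d` on. -/
theorem call (hf : PolyTime len f) (d : ℕ) :
    ∃ (p : Prog C) (P : Polynomial ℕ), ∀ s : Store C, ∃ (T : ℕ) (s' : Store C),
      Exec len p s T s' ∧ s' d = f (s d) ∧ (∀ y < d, s' y = s y) ∧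
      T ≤ P.eval ((s d).size len) := by
  obtain ⟨p, P, hp⟩ := hf
  refine ⟨p.rename (d + ·), P, fun s => ?_⟩
  obtain ⟨T, s', e, h, hT⟩ := hp (fun x => s (d + x))
  obtain ⟨s₁, e₁, h₁, k₁⟩ := e.rename (add_right_injective d) s (fun _ => rfl)
  refine ⟨T, s₁, e₁, (h₁ 0).trans h, fun y hy => k₁ y ?_, hT⟩
  rintro ⟨x, rfl⟩
  simp at hy

theorem size_le (hf : PolyTime len f) :
    ∃ P : Polynomial ℕ, ∀ x, (f x).size len ≤ P.eval (x.size len) := by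
  obtain ⟨p, P, hp⟩ := hf
  refine ⟨Polynomial.X + P, fun x => ?_⟩
  obtain ⟨T, s', e, h, hT⟩ := hp (fun _ => x)
  have := e.size_le 0
  rw [h] at this
  simp only [Polynomial.eval_add, Polynomial.eval_X]
  omega

protected theorem id : PolyTime len (fun x : Tree C => x) :=
  ⟨.skip, 1, fun s => ⟨1, s, .skip s, rfl, by simp⟩⟩

theorem nil : PolyTime len (fun _ : Tree C => .nil) :=
  ⟨.setNil 0, 1, fun s => ⟨1, _, .setNil 0 s, by simp, by simp⟩⟩

theorem atom (c : C) : PolyTime len (fun _ : Tree C => .atom c) :=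
  ⟨.setAtom 0 c, Polynomial.C (1 + len c), fun s => ⟨_, _, .setAtom 0 c s, by simp, by simp⟩⟩

theorem left : PolyTime len (Tree.left : Tree C → Tree C) :=
  ⟨.left 0 0, 1 + Polynomial.X, fun s => ⟨_, _, .left 0 0 s, by simp, by simp⟩⟩

theorem right : PolyTime len (Tree.right : Tree C → Tree C) :=
  ⟨.right 0 0, 1 + Polynomial.X, fun s => ⟨_, _, .right 0 0 s, by simp, by simp⟩⟩

theorem comp (hf : PolyTime len f) (hg : PolyTime len g) : PolyTime len (fun x => f (g x)) := by
  obtain ⟨Q, hQ⟩ := hg.size_le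
  obtain ⟨p, P, hp⟩ := hf
  obtain ⟨p', P', hp'⟩ := hg
  refine ⟨.seq p' p, P' + P.comp Q, fun s => ?_⟩
  obtain ⟨T₁, s₁, e₁, h₁, b₁⟩ := hp' s
  obtain ⟨T₂, s₂, e₂, h₂, b₂⟩ := hp s₁
  refine ⟨_, s₂, .seq e₁ e₂, by rw [h₂, h₁], ?_⟩
  simp only [Polynomial.eval_add, Polynomial.eval_comp]
  rw [h₁] at b₂
  have := eval_mono P (hQ (s 0))
  omega

theorem cons (hf : PolyTime len f) (hg : PolyTime len g) :
    PolyTime len (fun x => .cons (f x) (g x)) := by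
  obtain ⟨Q₁, hQ₁⟩ := hf.size_le
  obtain ⟨Q₂, hQ₂⟩ := hg.size_le
  obtain ⟨p₁, P₁, hp₁⟩ := hf.call 1
  obtain ⟨p₂, P₂, hp₂⟩ := hg.call 2
  refine ⟨.seq (.copy 1 0) (.seq p₁ (.seq (.copy 2 0) (.seq p₂ (.cons 0 1 2)))),
    (1 + Polynomial.X) + (P₁ + ((1 + Polynomial.X) + (P₂ + (1 + Q₁ + Q₂)))), fun s => ?_⟩
  have e₁ := Exec.copy (len := len) 1 0 s
  set s₁ := Function.update s 1 (s 0) with hs₁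
  obtain ⟨T₂, s₂, e₂, h₂, k₂, b₂⟩ := hp₁ s₁
  have e₃ := Exec.copy (len := len) 2 0 s₂
  set s₃ := Function.update s₂ 2 (s₂ 0) with hs₃
  obtain ⟨T₄, s₄, e₄, h₄, k₄, b₄⟩ := hp₂ s₃
  have r20 : s₂ 0 = s 0 := by rw [k₂ 0 (by omega), hs₁]; simp
  have r11 : s₁ 1 = s 0 := by simp [hs₁]
  have r32 : s₃ 2 = s 0 := by simp [hs₃, r20]
  have r41 : s₄ 1 = f (s 0) := by
    rw [k₄ 1 (by omega), hs₃, Function.update_of_ne (by omega), h₂, r11]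
  rw [r32] at h₄ b₄
  rw [r11] at b₂
  rw [r20] at e₃
  refine ⟨_, _, .seq e₁ (.seq e₂ (.seq e₃ (.seq e₄ (.cons 0 1 2 s₄)))), by simp [r41, h₄], ?_⟩
  have := hQ₁ (s 0)
  have := hQ₂ (s 0)
  simp only [Polynomial.eval_add, Polynomial.eval_X, Polynomial.eval_one, r41, h₄]
  omega

open Classical in
theorem cond (hf : PolyTime len f) (hg : PolyTime len g) (hh : PolyTime len h) :
    PolyTime len (fun x => if (f x).IsCons then g x else h x) := by
  obtain ⟨p₁, P₁, hp₁⟩ := hf.call 1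
  obtain ⟨p₂, P₂, hp₂⟩ := hg
  obtain ⟨p₃, P₃, hp₃⟩ := hh
  refine ⟨.seq (.copy 1 0) (.seq p₁ (.ifCons 1 p₂ p₃)),
    (1 + Polynomial.X) + (P₁ + (1 + (P₂ + P₃))), fun s => ?_⟩
  have e₁ := Exec.copy (len := len) 1 0 s
  set s₁ := Function.update s 1 (s 0) with hs₁
  obtain ⟨T₂, s₂, e₂, h₂, k₂, b₂⟩ := hp₁ s₁
  have r20 : s₂ 0 = s 0 := by rw [k₂ 0 (by omega), hs₁]; simp
  have r11 : s₁ 1 = s 0 := by simp [hs₁]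
  rw [r11] at h₂ b₂
  simp only [Polynomial.eval_add, Polynomial.eval_X, Polynomial.eval_one]
  by_cases hc : (f (s 0)).IsCons
  · obtain ⟨T₃, s₃, e₃, h₃, b₃⟩ := hp₂ s₂
    rw [r20] at h₃ b₃
    refine ⟨_, _, .seq e₁ (.seq e₂ (.ifCons_pos (by rwa [h₂]) e₃)), by rw [h₃, if_pos hc], ?_⟩
    omega
  · obtain ⟨T₃, s₃, e₃, h₃, b₃⟩ := hp₃ s₂
    rw [r20] at h₃ b₃
    refine ⟨_, _, .seq e₁ (.seq e₂ (.ifCons_neg (by rwa [h₂]) e₃)), by rw [h₃, if_neg hc], ?_⟩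
    omega

end PolyTime

open Classical in
theorem PolyTime.atomLe {f g : Tree C → Tree C} (hf : PolyTime len f) (hg : PolyTime len g) :
    PolyTime len (fun x => Tree.ofBool (decide ((f x).AtomLe (g x)))) := by
  have key : PolyTime len
      (fun x : Tree C => Tree.ofBool (decide (x.left.AtomLe x.right))) := by
    refine ⟨.seq (.left 1 0) (.seq (.right 2 0) (.ifLe 1 2
      (.seq (.setNil 0) (.cons 0 0 0)) (.setNil 0))),
      (1 + Polynomial.X) + ((1 + Polynomial.X) +
        (1 + Polynomial.X + Polynomial.X + Polynomial.C 4)),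
      fun s => ?_⟩
    have e₁ := Exec.left (len := len) 1 0 s
    set s₁ := Function.update s 1 (s 0).left with hs₁
    have e₂ := Exec.right (len := len) 2 0 s₁
    set s₂ := Function.update s₁ 2 (s₁ 0).right with hs₂
    have r10 : s₁ 0 = s 0 := by simp [hs₁]
    have r21 : s₂ 1 = (s 0).left := by simp [hs₂, hs₁]
    have r22 : s₂ 2 = (s 0).right := by simp [hs₂, r10]
    have l := Tree.size_left_le (len := len) (s 0)
    have r := Tree.size_right_le (len := len) (s 0)
    rw [r10] at e₂
    simp only [Polynomial.eval_add, Polynomial.eval_X, Polynomial.eval_one, Polynomial.eval_C]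
    by_cases hc : (s 0).left.AtomLe (s 0).right
    · refine ⟨_, _, .seq e₁ (.seq e₂ (.ifLe_pos (by rwa [r21, r22])
        (.seq (.setNil 0 _) (.cons 0 0 0 _)))), by simp [hc, Tree.ofBool], ?_⟩
      simp [r21, r22, Tree.size]
      omega
    · refine ⟨_, _, .seq e₁ (.seq e₂ (.ifLe_neg (by rwa [r21, r22]) (.setNil 0 _))),
        by simp [hc, Tree.ofBool], ?_⟩
      simp only [r21, r22]
      omega
  exact key.comp (hf.cons hg)

theorem PolyTime.const (t : Tree C) : PolyTime len (fun _ : Tree C => t) := by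
  induction t with
  | nil => exact .nil
  | atom c => exact .atom c
  | cons l r hl hr => exact hl.cons hr

end

section

variable {C : Type u} {len : C → ℕ}

/-! ### Lists and loops -/

/-- The list of the trees that hang off the right spine; every tree is read as a list. -/
def Tree.toList : Tree C → List (Tree C)
  | .cons l r => l :: r.toList
  | _ => []

@[simp] theorem toList_encodeList (l : List (Tree C)) : (encodeList l).toList = l := by
  induction l <;> simp_all [encodeList, Tree.toList]

theorem Tree.length_toList_le (t : Tree C) : t.toList.length ≤ t.size len := by
  induction t with
  | cons l r _ ih => simp [Tree.toList, Tree.size]; omega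
  | _ => simp [Tree.toList]

theorem Tree.size_le_of_mem_toList {t a : Tree C} (h : a ∈ t.toList) :
    a.size len ≤ t.size len := by
  induction t with
  | cons l r _ ih =>
    simp only [Tree.toList, List.mem_cons] at h
    simp only [Tree.size]
    rcases h with rfl | h
    · omega
    · have := ih h; omega
  | _ => simp [Tree.toList] at h

theorem size_encodeList (l : List (Tree C)) :
    (encodeList l).size len = 1 + (l.map fun t => 1 + t.size len).sum := by
  induction l with
  | nil => simp [encodeList, Tree.size]
  | cons a l ih => simp [encodeList, Tree.size, ih]; omega

theorem size_encodeList_toList_le (t : Tree C) :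
    (encodeList t.toList).size len ≤ t.size len := by
  induction t with
  | cons l r _ ih => simp [Tree.toList, encodeList, Tree.size]; omega
  | _ => simp [Tree.toList, encodeList, Tree.size]

theorem isCons_encodeList {l : List (Tree C)} : (encodeList l).IsCons ↔ l ≠ [] := by
  cases l <;> simp [encodeList, Tree.IsCons]

variable [LinearOrder C]

namespace PolyTime

variable {f g l i step : Tree C → Tree C}

/-- A loop over a list whose accumulator stays polynomially small. The body sees the accumulator,
the current item and the input. -/
theorem foldl (hl : PolyTime len l) (hi : PolyTime len i) (hstep : PolyTime len step)
    (B : Polynomial ℕ)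
    (hB : ∀ x a b, (l x).toList = a ++ b →
      (a.foldl (fun acc it => step (.cons acc (.cons it x))) (i x)).size len ≤
        B.eval (x.size len)) :
    PolyTime len
      (fun x => (l x).toList.foldl (fun acc it => step (.cons acc (.cons it x))) (i x)) := by
  obtain ⟨L, hL⟩ := hl.size_le
  obtain ⟨I, hI⟩ := hi.size_le
  obtain ⟨pl, Pl, hpl⟩ := hl.call 1
  obtain ⟨pi, Pi, hpi⟩ := hi.call 2
  obtain ⟨ps, Ps, hps⟩ := hstep.call 3
  -- register 0 holds the input, 1 the rest of the list, 2 the accumulator; 3 is for scratch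
  let body : Prog C := .seq (.left 3 1) (.seq (.right 1 1) (.seq (.cons 3 3 0)
    (.seq (.cons 3 2 3) (.seq ps (.copy 2 3)))))
  obtain ⟨S, hS⟩ := hstep.size_le
  -- a bound for the time of one round, in terms of `|x| + |list| + |accumulator|`
  let R : Polynomial ℕ := 9 * Polynomial.X + Polynomial.C 9 +
    Ps.comp (2 * Polynomial.X + Polynomial.C 2) + S.comp (2 * Polynomial.X + Polynomial.C 2)
  have two (n : ℕ) : (2 : Polynomial ℕ).eval n = 2 := by
    rw [show (2 : Polynomial ℕ) = Polynomial.C 2 from rfl, Polynomial.eval_C]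
  have nine (n : ℕ) : (9 : Polynomial ℕ).eval n = 9 := by
    rw [show (9 : Polynomial ℕ) = Polynomial.C 9 from rfl, Polynomial.eval_C]
  have hbody : ∀ (s : Store C) (a r : Tree C), s 1 = .cons a r → ∃ T s', Exec len body s T s' ∧
      s' 0 = s 0 ∧ s' 1 = r ∧ s' 2 = step (.cons (s 2) (.cons a (s 0))) ∧
      T ≤ R.eval ((s 0).size len + (s 1).size len + (s 2).size len) := by
    intro s a r hs
    have e₁ := Exec.left (len := len) 3 1 s
    set s₁ := Function.update s 3 (s 1).left with hs₁
    have e₂ := Exec.right (len := len) 1 1 s₁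
    set s₂ := Function.update s₁ 1 (s₁ 1).right with hs₂
    have e₃ := Exec.cons (len := len) 3 3 0 s₂
    set s₃ := Function.update s₂ 3 (.cons (s₂ 3) (s₂ 0)) with hs₃
    have e₄ := Exec.cons (len := len) 3 2 3 s₃
    set s₄ := Function.update s₃ 3 (.cons (s₃ 2) (s₃ 3)) with hs₄
    obtain ⟨T₅, s₅, e₅, h₅, k₅, b₅⟩ := hps s₄
    have e₆ := Exec.copy (len := len) 2 3 s₅
    have r11 : s₁ 1 = s 1 := by simp [hs₁]
    have r23 : s₂ 3 = a := by simp [hs₂, hs₁, hs, Tree.left]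
    have r20 : s₂ 0 = s 0 := by simp [hs₂, hs₁]
    have r32 : s₃ 2 = s 2 := by simp [hs₃, hs₂, hs₁]
    have r33 : s₃ 3 = .cons a (s 0) := by simp [hs₃, r23, r20]
    have r43 : s₄ 3 = .cons (s 2) (.cons a (s 0)) := by simp [hs₄, r32, r33]
    have r40 : s₄ 0 = s 0 := by simp [hs₄, hs₃, hs₂, hs₁]
    have r41 : s₄ 1 = r := by simp [hs₄, hs₃, hs₂, hs₁, hs, Tree.right]
    rw [r43] at h₅ b₅
    refine ⟨_, _, .seq e₁ (.seq e₂ (.seq e₃ (.seq e₄ (.seq e₅ e₆)))), ?_, ?_, ?_, ?_⟩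
    · rw [Function.update_of_ne (by omega), k₅ 0 (by omega), r40]
    · rw [Function.update_of_ne (by omega), k₅ 1 (by omega), r41]
    · rw [Function.update_self, h₅]
    · have hsz : (Tree.cons (s 2) (.cons a (s 0))).size len ≤
          2 * ((s 0).size len + (s 1).size len + (s 2).size len) + 2 := by
        rw [hs]; simp only [Tree.size]; omega
      have q₁ := eval_mono Ps hsz
      have q₂ := (hS (Tree.cons (s 2) (.cons a (s 0)))).trans (eval_mono S hsz)
      have q₃ : a.size len ≤ (s 1).size len := by rw [hs]; simp only [Tree.size]; omega
      simp only [r11, r23, r20, r32, r33, h₅, R, Polynomial.eval_add, Polynomial.eval_mul,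
        Polynomial.eval_comp, Polynomial.eval_X, Polynomial.eval_C, two, nine, Tree.size]
      omega
  -- `M` bounds the input together with the list, and all accumulators
  have hloop : ∀ (M : ℕ) (t : Tree C) (s : Store C), s 1 = t →
      (s 0).size len + t.size len ≤ M →
      (∀ a b, t.toList = a ++ b →
        (a.foldl (fun acc it => step (.cons acc (.cons it (s 0)))) (s 2)).size len ≤ M) →
      ∃ T s', Exec len (.whileCons 1 body) s T s' ∧
        s' 2 = t.toList.foldl (fun acc it => step (.cons acc (.cons it (s 0)))) (s 2) ∧
        T ≤ t.size len * (1 + R.eval (M + M)) := by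
    intro M t
    induction t with
    | cons a r _ ih =>
      intro s hs hM hacc
      obtain ⟨T₁, s₁, e₁, h₀, h₁, h₂, b₁⟩ := hbody s a r hs
      obtain ⟨T₂, s₂, e₂, h₃, b₂⟩ := ih s₁ h₁
        (by rw [h₀]; simp only [Tree.size] at hM; omega) (by
          intro u v huv
          have := hacc (a :: u) v (by simp [Tree.toList, huv])
          rwa [List.foldl_cons, ← h₂, ← h₀] at this)
      refine ⟨_, _, .while_step ⟨a, r, hs⟩ e₁ e₂, ?_, ?_⟩
      · rw [h₃, h₂, h₀]; rfl
      · have q := hacc [] _ rfl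
        rw [List.foldl_nil] at q
        have q' := b₁.trans (eval_mono R (b := M + M) (by rw [hs]; omega))
        simp only [Tree.size]
        calc 1 + T₁ + T₂ ≤ (1 + R.eval (M + M)) + r.size len * (1 + R.eval (M + M)) := by omega
          _ = (1 + r.size len) * (1 + R.eval (M + M)) := by ring
          _ ≤ _ := by gcongr; omega
    | nil =>
      intro s hs hM hacc
      exact ⟨1, s, Exec.while_stop (by rintro ⟨a, b, h⟩; rw [hs] at h; cases h), rfl,
        by simp [Tree.size]⟩
    | atom c =>
      intro s hs hM hacc
      refine ⟨1, s, Exec.while_stop (by rintro ⟨a, b, h⟩; rw [hs] at h; cases h), rfl, ?_⟩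
      calc 1 = 1 * 1 := rfl
        _ ≤ _ := Nat.mul_le_mul (Tree.one_le_size _) (by omega)
  let M : Polynomial ℕ := Polynomial.X + L + B
  refine ⟨.seq (.copy 1 0) (.seq pl (.seq (.copy 2 0) (.seq pi (.seq (.whileCons 1 body)
    (.copy 0 2))))), (1 + Polynomial.X) + (Pl + ((1 + Polynomial.X) + (Pi +
      (L * (1 + R.comp (M + M)) + (1 + B))))), fun s => ?_⟩
  have e₁ := Exec.copy (len := len) 1 0 s
  set s₁ := Function.update s 1 (s 0) with hs₁
  obtain ⟨T₂, s₂, e₂, h₂, k₂, b₂⟩ := hpl s₁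
  have e₃ := Exec.copy (len := len) 2 0 s₂
  set s₃ := Function.update s₂ 2 (s₂ 0) with hs₃
  obtain ⟨T₄, s₄, e₄, h₄, k₄, b₄⟩ := hpi s₃
  have r11 : s₁ 1 = s 0 := by simp [hs₁]
  have r20 : s₂ 0 = s 0 := by rw [k₂ 0 (by omega), hs₁]; simp
  have r32 : s₃ 2 = s 0 := by simp [hs₃, r20]
  have r40 : s₄ 0 = s 0 := by rw [k₄ 0 (by omega), hs₃]; simp [r20]
  have r41 : s₄ 1 = l (s 0) := by
    rw [k₄ 1 (by omega), hs₃, Function.update_of_ne (by omega), h₂, r11]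
  rw [r32] at h₄ b₄
  rw [r11] at b₂
  have hlx := hL (s 0)
  obtain ⟨T₅, s₅, e₅, h₅, b₅⟩ := hloop (M.eval ((s 0).size len)) _ s₄ r41
    (by rw [r40]; simp only [M, Polynomial.eval_add, Polynomial.eval_X]; omega)
    (by
      intro a b hab
      rw [r40, h₄]
      have := hB (s 0) a b hab
      simp only [M, Polynomial.eval_add, Polynomial.eval_X]
      omega)
  rw [r40, h₄] at h₅
  refine ⟨_, _, .seq e₁ (.seq e₂ (.seq e₃ (.seq e₄ (.seq e₅ (.copy 0 2 s₅))))), ?_, ?_⟩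
  · rw [Function.update_self, h₅]
  · have q := hB (s 0) (l (s 0)).toList [] (by simp)
    have q' := Nat.mul_le_mul_right (1 + R.eval (M.eval ((s 0).size len) +
      M.eval ((s 0).size len))) hlx
    rw [h₅, r20]
    simp only [Polynomial.eval_add, Polynomial.eval_mul, Polynomial.eval_comp, Polynomial.eval_X,
      Polynomial.eval_one] at *
    omega

end PolyTime

end

section

variable {C : Type u} {len : C → ℕ}

/-- The items of `a`, in reverse, followed by `b`. -/
def Tree.revAppend (a b : Tree C) : Tree C := a.toList.foldl (fun acc it => .cons it acc) b

theorem revAppend_encodeList (a : Tree C) (m : List (Tree C)) :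
    a.revAppend (encodeList m) = encodeList (a.toList.reverse ++ m) := by
  unfold Tree.revAppend
  induction a.toList generalizing m with
  | nil => rfl
  | cons t l ih => simpa [encodeList] using ih (t :: m)

theorem size_foldl_cons (l : List (Tree C)) (b : Tree C) :
    (l.foldl (fun acc it => Tree.cons it acc) b).size len + 1 =
      (encodeList l).size len + b.size len := by
  induction l generalizing b with
  | nil => simp [encodeList, Tree.size, add_comm]
  | cons t l ih => simp only [List.foldl_cons, ih, encodeList, Tree.size]; omega

theorem size_revAppend_le (a b : Tree C) :
    (a.revAppend b).size len ≤ a.size len + b.size len := by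
  have := size_foldl_cons (len := len) a.toList b
  have := size_encodeList_toList_le (len := len) a
  unfold Tree.revAppend
  omega

theorem foldl_revAppend (F : Tree C → Tree C) (a m : List (Tree C)) :
    a.foldl (fun acc it => (F it).revAppend acc) (encodeList m) =
      encodeList ((a.flatMap fun it => (F it).toList).reverse ++ m) := by
  induction a generalizing m with
  | nil => rfl
  | cons t l ih => rw [List.foldl_cons, revAppend_encodeList, ih]; simp

theorem size_foldl_revAppend_le (F : Tree C → Tree C) (S : ℕ) (a : List (Tree C)) (b : Tree C)
    (h : ∀ it ∈ a, (F it).size len ≤ S) :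
    (a.foldl (fun acc it => (F it).revAppend acc) b).size len ≤ a.length * S + b.size len := by
  induction a generalizing b with
  | nil => simp
  | cons t l ih =>
    have h₁ := ih ((F t).revAppend b) fun it hit => h it (List.mem_cons_of_mem _ hit)
    have h₂ := size_revAppend_le (len := len) (F t) b
    have h₃ := h t List.mem_cons_self
    rw [List.foldl_cons, List.length_cons]
    calc _ ≤ _ := h₁
      _ ≤ l.length * S + (S + b.size len) := by gcongr; omega
      _ = _ := by ring

/-- The subtree at a path (`true` for left, `nil` beyond the leaves). -/
def Tree.sub : List Bool → Tree C → Tree C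
  | [], t => t
  | true :: w, t => t.left.sub w
  | false :: w, t => t.right.sub w

/-- The tree with its constants replaced along `σ`. -/
def Tree.map (σ : C → C) : Tree C → Tree C
  | .nil => .nil
  | .atom c => .atom (σ c)
  | .cons l r => .cons (l.map σ) (r.map σ)

/-- The constants at the leaves. -/
def Tree.atoms : Tree C → Set C
  | .nil => ∅
  | .atom c => {c}
  | .cons l r => l.atoms ∪ r.atoms

/-- The number of edges on a longest path. -/
def Tree.depth : Tree C → ℕ
  | .cons l r => max l.depth r.depth + 1
  | _ => 0

theorem sub_nil (w : List Bool) : (Tree.nil : Tree C).sub w = .nil := by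
  induction w with
  | nil => rfl
  | cons b w ih => cases b <;> simpa [Tree.sub, Tree.left, Tree.right] using ih

theorem sub_eq_nil_of_depth_lt {t : Tree C} {w : List Bool} (h : t.depth < w.length) :
    t.sub w = .nil := by
  induction w generalizing t with
  | nil => simp at h
  | cons b w ih =>
    cases t with
    | cons l r =>
      simp only [Tree.depth, List.length_cons] at h
      cases b
      · exact ih (t := r) (by omega)
      · exact ih (t := l) (by omega)
    | _ => cases b <;> exact sub_nil w

theorem exists_sub_of_mem_atoms {t : Tree C} {c : C} (h : c ∈ t.atoms) :
    ∃ w, t.sub w = .atom c := by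
  induction t with
  | nil => exact h.elim
  | atom d => exact ⟨[], by rw [Set.mem_singleton_iff.1 h]; rfl⟩
  | cons l r ihl ihr =>
    rcases h with h | h
    · obtain ⟨w, hw⟩ := ihl h
      exact ⟨true :: w, hw⟩
    · obtain ⟨w, hw⟩ := ihr h
      exact ⟨false :: w, hw⟩

/-- Two trees of the same shape correspond along any `σ` that maps the constants of the first to
those at the same places of the second. -/
theorem eq_map_of_sub {σ : C → C} {x y : Tree C}
    (hcons : ∀ w, (x.sub w).IsCons ↔ (y.sub w).IsCons)
    (hatom : ∀ w, (∃ c, x.sub w = .atom c) ↔ ∃ c, y.sub w = .atom c)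
    (hσ : ∀ w c d, x.sub w = .atom c → y.sub w = .atom d → σ c = d) : y = x.map σ := by
  induction x generalizing y with
  | nil =>
    have h₁ := hcons []
    have h₂ := hatom []
    cases y <;> simp_all [Tree.sub, Tree.IsCons, Tree.map]
  | atom c =>
    have h₁ := hcons []
    have h₂ := hatom []
    have h₃ := hσ [] c
    cases y <;> simp_all [Tree.sub, Tree.IsCons, Tree.map]
  | cons l r ihl ihr =>
    have h₁ := hcons []
    cases y with
    | cons l' r' =>
      rw [Tree.map, ← ihl (y := l') (fun w => hcons (true :: w)) (fun w => hatom (true :: w))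
        (fun w => hσ (true :: w)), ← ihr (y := r') (fun w => hcons (false :: w))
        (fun w => hatom (false :: w)) (fun w => hσ (false :: w))]
    | _ => simp [Tree.sub, Tree.IsCons] at h₁

variable [LinearOrder C]

namespace PolyTime

variable {f g l c : Tree C → Tree C}

theorem revAppend (hf : PolyTime len f) (hg : PolyTime len g) :
    PolyTime len (fun x => (f x).revAppend (g x)) := by
  obtain ⟨F, hF⟩ := hf.size_le
  obtain ⟨G, hG⟩ := hg.size_le
  refine foldl (step := fun y => .cons y.right.left y.left) hf hg
    ((left.comp right).cons left) (F + G) fun x a b hab => ?_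
  have h₁ := size_foldl_cons (len := len) a (g x)
  have h₂ : (encodeList a).size len ≤ (f x).size len := by
    refine le_trans ?_ (size_encodeList_toList_le _)
    rw [hab, size_encodeList, size_encodeList]
    simp
  have := hF x
  have := hG x
  simp only [Polynomial.eval_add, Tree.left, Tree.right]
  omega

/-- The loop collects its results by consing, which reverses the list. -/
theorem flatMap (hl : PolyTime len l) (hf : PolyTime len f) :
    PolyTime len (fun x =>
      encodeList ((l x).toList.flatMap fun it => (f (.cons it x)).toList).reverse) := by
  obtain ⟨L, hL⟩ := hl.size_le
  obtain ⟨F, hF⟩ := hf.size_le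
  have := foldl (step := fun y => (f y.right).revAppend y.left) hl nil
    ((hf.comp right).revAppend left)
    (L * F.comp (1 + L + Polynomial.X) + 1) fun x a b hab => by
      simp only [Tree.left, Tree.right]
      refine (size_foldl_revAppend_le (fun it => f (.cons it x))
        (F.eval (1 + L.eval (x.size len) + x.size len)) a .nil fun it hit => ?_).trans ?_
      · refine (hF _).trans (eval_mono F ?_)
        have := Tree.size_le_of_mem_toList (len := len) (t := l x) (a := it) (by simp [hab, hit])
        have := hL x
        simp only [Tree.size]
        omega
      · have h₁ : a.length ≤ L.eval (x.size len) := by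
          have h₂ := Tree.length_toList_le (len := len) (l x)
          have := hL x
          rw [hab, List.length_append] at h₂
          omega
        simp only [Tree.size, Polynomial.eval_add, Polynomial.eval_mul, Polynomial.eval_comp,
          Polynomial.eval_X, Polynomial.eval_one]
        gcongr
  convert this using 2 with x
  simp only [Tree.left, Tree.right]
  have := foldl_revAppend (fun it => f (.cons it x)) (l x).toList []
  simp only [List.append_nil] at this
  exact this.symm

open Classical in
theorem filter (hl : PolyTime len l) (hc : PolyTime len c) :
    PolyTime len (fun x =>
      encodeList ((l x).toList.filter fun it => (c (.cons it x)).IsCons).reverse) := by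
  convert hl.flatMap (hc.cond (left.cons nil) nil) using 4 with x
  induction (l x).toList with
  | nil => rfl
  | cons t m ih =>
    rw [List.filter_cons, List.flatMap_cons, ih]
    by_cases h : (c (.cons t x)).IsCons <;> simp [h, Tree.left, Tree.toList]

theorem exists_any (hl : PolyTime len l) (hc : PolyTime len c) :
    ∃ e, PolyTime len e ∧
      ∀ x, (e x).IsCons ↔ ∃ it ∈ (l x).toList, (c (.cons it x)).IsCons := by
  refine ⟨_, hl.filter hc, fun x => ?_⟩
  rw [isCons_encodeList]
  simp [List.filter_eq_nil_iff]

/-- The lists of at most `k` members of a given list. -/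
theorem exists_tuples (hl : PolyTime len l) (k : ℕ) :
    ∃ e, PolyTime len e ∧ ∀ x y, y ∈ (e x).toList ↔
      ∃ w : List (Tree C), w.length ≤ k ∧ (∀ a ∈ w, a ∈ (l x).toList) ∧ y = encodeList w := by
  induction k with
  | zero =>
    refine ⟨_, nil.cons nil, fun x y => ?_⟩
    simp only [Tree.toList, List.mem_singleton, Nat.le_zero, List.length_eq_zero_iff]
    constructor
    · rintro rfl
      exact ⟨[], rfl, by simp, rfl⟩
    · rintro ⟨_, rfl, _, rfl⟩
      rfl
  | succ k ih =>
    obtain ⟨e, he, h⟩ := ih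
    refine ⟨_, nil.cons (he.flatMap ((hl.comp right).flatMap
      ((left.cons (left.comp right)).cons nil))), fun x y => ?_⟩
    simp only [Tree.toList, Tree.right, Tree.left, toList_encodeList, List.mem_cons,
      List.mem_reverse, List.mem_flatMap, List.not_mem_nil, or_false]
    constructor
    · rintro (rfl | ⟨t, ht, a, ha, rfl⟩)
      · exact ⟨[], by simp, by simp, rfl⟩
      · obtain ⟨w, hw, hm, rfl⟩ := (h x t).1 ht
        exact ⟨a :: w, by simpa using hw, by simpa [ha] using hm, rfl⟩
    · rintro ⟨_ | ⟨a, w⟩, hw, hm, rfl⟩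
      · exact .inl rfl
      · exact .inr ⟨encodeList w, (h x _).2 ⟨w, by simpa using hw,
          fun b hb => hm b (by simp [hb]), rfl⟩, a, hm a (by simp), rfl⟩

/-- A loop with as many rounds as a list has items. -/
theorem iterate (hl : PolyTime len l) (hf : PolyTime len f) (B : Polynomial ℕ)
    (hB : ∀ acc x, (f (.cons acc x)).size len ≤ B.eval (x.size len)) :
    PolyTime len (fun x => (fun acc => f (.cons acc x))^[(l x).toList.length] .nil) := by
  convert foldl (step := fun y => f (.cons y.left y.right.right)) hl nil
    (hf.comp (left.cons (right.comp right))) (B + 1) fun x a b _ => ?_ using 2 with x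
  · simp only [Tree.left, Tree.right]
    rw [List.foldl_const]
  · rcases List.eq_nil_or_concat' a with rfl | ⟨a, t, rfl⟩
    · simp [Tree.size]
    · rw [List.foldl_append]
      simp only [List.foldl_cons, List.foldl_nil, Tree.left, Tree.right, Polynomial.eval_add]
      exact (hB _ _).trans (Nat.le_add_right _ _)

end PolyTime

/-! ### Decision trees -/

/-- A property that depends only on the outcomes of finitely many tests is decided by asking all of
them. -/
theorem exists_decision_of_tests {τs : Set (Tree C → Tree C)} (hfin : τs.Finite)
    (hτ : ∀ τ ∈ τs, PolyTime len τ) :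
    ∀ (S : Set (Tree C)) (Φ : Tree C → Prop),
      (∀ x ∈ S, ∀ y ∈ S, (∀ τ ∈ τs, (τ x).IsCons ↔ (τ y).IsCons) → Φ x → Φ y) →
      ∃ e, PolyTime len e ∧ ∀ x ∈ S, (e x).IsCons ↔ Φ x := by
  classical
  induction τs, hfin using Set.Finite.induction_on with
  | empty =>
    intro S Φ h
    by_cases hx : ∃ x ∈ S, Φ x
    · obtain ⟨x, hx, hΦ⟩ := hx
      exact ⟨_, .const (.ofBool true), fun y hy => by simpa using h x hx y hy (by simp) hΦ⟩
    · push Not at hx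
      exact ⟨_, .const (.ofBool false), fun y hy => by simpa using hx y hy⟩
  | @insert τ τs _ _ ih =>
    intro S Φ h
    have hτ' : ∀ τ ∈ τs, PolyTime len τ := fun σ hσ => hτ σ (.inr hσ)
    obtain ⟨e₁, he₁, h₁⟩ := ih hτ' {x ∈ S | (τ x).IsCons} Φ fun x hx y hy hxy =>
      h x hx.1 y hy.1 fun σ hσ => by
        rcases hσ with rfl | hσ
        · exact iff_of_true hx.2 hy.2
        · exact hxy σ hσ
    obtain ⟨e₂, he₂, h₂⟩ := ih hτ' {x ∈ S | ¬ (τ x).IsCons} Φ fun x hx y hy hxy =>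
      h x hx.1 y hy.1 fun σ hσ => by
        rcases hσ with rfl | hσ
        · exact iff_of_false hx.2 hy.2
        · exact hxy σ hσ
    refine ⟨_, (hτ τ (.inl rfl)).cond he₁ he₂, fun x hx => ?_⟩
    by_cases hc : (τ x).IsCons
    · simpa [hc] using h₁ x ⟨hx, hc⟩
    · simpa [hc] using h₂ x ⟨hx, hc⟩

theorem PolyTime.sub (w : List Bool) : PolyTime len (Tree.sub w : Tree C → Tree C) := by
  induction w with
  | nil => exact .id
  | cons b w ih =>
    cases b
    · exact ih.comp .right
    · exact ih.comp .left

theorem atomLe_self_iff {t : Tree C} : t.AtomLe t ↔ ∃ c, t = .atom c := by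
  constructor
  · rintro ⟨a, b, h, _⟩
    exact ⟨a, h⟩
  · rintro ⟨a, h⟩
    exact ⟨a, a, h, h, le_rfl⟩

/-- A property of trees of bounded depth is decided in polynomial time if it depends only on the
shape of the tree and on the order of its constants among themselves and relative to a finite
set `K`. -/
theorem exists_decision {K : Set C} (hK : K.Finite) (N : ℕ) (Φ : Tree C → Prop)
    (hΦ : ∀ (x : Tree C) (σ : C → C), StrictMonoOn σ (K ∪ x.atoms) → (∀ c ∈ K, σ c = c) →
      Φ x → Φ (x.map σ)) :
    ∃ e, PolyTime len e ∧ ∀ x, x.depth ≤ N → ((e x).IsCons ↔ Φ x) := by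
  classical
  let P : Set (List Bool) := {w | w.length ≤ N}
  have hP : P.Finite := List.finite_length_le _ _
  let E : Set (Tree C → Tree C) := Tree.sub '' P ∪ (fun c _ => .atom c) '' K
  have hE : E.Finite := (hP.image _).union (hK.image _)
  have hEP : ∀ e ∈ E, PolyTime len e := by
    rintro e (⟨w, _, rfl⟩ | ⟨c, _, rfl⟩)
    · exact .sub w
    · exact .atom c
  let τs : Set (Tree C → Tree C) := Tree.sub '' P ∪
    Set.image2 (fun e e' x => Tree.ofBool (decide ((e x).AtomLe (e' x)))) E E
  refine exists_decision_of_tests (τs := τs) ((hP.image _).union (hE.image2 _ hE)) ?_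
    {x | x.depth ≤ N} Φ ?_
  · rintro τ (⟨w, _, rfl⟩ | ⟨e, he, e', he', rfl⟩)
    · exact .sub w
    · exact (hEP e he).atomLe (hEP e' he')
  intro x hx y hy hxy h
  have hle : ∀ e ∈ E, ∀ e' ∈ E, (e x).AtomLe (e' x) ↔ (e y).AtomLe (e' y) := by
    intro e he e' he'
    simpa using hxy _ (.inr ⟨e, he, e', he', rfl⟩)
  have hlong : ∀ w ∉ P, x.sub w = .nil ∧ y.sub w = .nil := by
    intro w hw
    simp only [P, Set.mem_ofPred_eq, not_le] at hw hx hy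
    exact ⟨sub_eq_nil_of_depth_lt (by omega), sub_eq_nil_of_depth_lt (by omega)⟩
  have hsub : ∀ w ∈ P, Tree.sub w ∈ E := fun w hw => .inl ⟨w, hw, rfl⟩
  have hcons : ∀ w, (x.sub w).IsCons ↔ (y.sub w).IsCons := by
    intro w
    by_cases hw : w ∈ P
    · exact hxy _ (.inl ⟨w, hw, rfl⟩)
    · rw [(hlong w hw).1, (hlong w hw).2]
  have hatom : ∀ w, (∃ c, x.sub w = .atom c) ↔ ∃ c, y.sub w = .atom c := by
    intro w
    by_cases hw : w ∈ P
    · rw [← atomLe_self_iff, ← atomLe_self_iff]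
      exact hle _ (hsub w hw) _ (hsub w hw)
    · rw [(hlong w hw).1, (hlong w hw).2]
  -- corresponding constants of the two trees; the constants of `K` correspond to themselves
  let r : C → C → Prop := fun c d => ∃ e ∈ E, e x = .atom c ∧ e y = .atom d
  have hr : ∀ c d c' d', r c d → r c' d' → (c ≤ c' ↔ d ≤ d') := by
    rintro c d c' d' ⟨e, he, h₁, h₂⟩ ⟨e', he', h₁', h₂'⟩
    simpa [Tree.AtomLe, h₁, h₂, h₁', h₂'] using hle e he e' he'
  have hrK : ∀ c ∈ K, r c c := fun c hc => ⟨_, .inr ⟨c, hc, rfl⟩, rfl, rfl⟩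
  have hrsub : ∀ w c d, x.sub w = .atom c → y.sub w = .atom d → r c d := by
    intro w c d hc hd
    by_cases hw : w ∈ P
    · exact ⟨_, hsub w hw, hc, hd⟩
    · rw [(hlong w hw).1] at hc; cases hc
  have hex : ∀ c ∈ K ∪ x.atoms, ∃ d, r c d := by
    rintro c (hc | hc)
    · exact ⟨c, hrK c hc⟩
    · obtain ⟨w, hw⟩ := exists_sub_of_mem_atoms hc
      obtain ⟨d, hd⟩ := (hatom w).1 ⟨c, hw⟩
      exact ⟨d, hrsub w c d hw hd⟩
  let σ : C → C := fun c => if h : ∃ d, r c d then h.choose else c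
  have hσ : ∀ c d, r c d → σ c = d := by
    intro c d h
    have h' : ∃ d, r c d := ⟨d, h⟩
    have e : σ c = h'.choose := dif_pos h'
    rw [e]
    exact le_antisymm ((hr _ _ _ _ h'.choose_spec h).1 le_rfl)
      ((hr _ _ _ _ h h'.choose_spec).1 le_rfl)
  rw [eq_map_of_sub (σ := σ) hcons hatom fun w c d hc hd => hσ c d (hrsub w c d hc hd)]
  refine hΦ x σ ?_ (fun c hc => hσ c c (hrK c hc)) h
  intro a ha b hb hab
  obtain ⟨a', ha'⟩ := hex a ha
  obtain ⟨b', hb'⟩ := hex b hb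
  rw [hσ a a' ha', hσ b b' hb']
  exact lt_of_not_ge fun h => absurd ((hr _ _ _ _ hb' ha').2 h) (not_le.2 hab)

end

section

variable {C : Type u} [LinearOrder C]

/-! ### Finite maps into a dense order -/

theorem exists_between_notMem [DenselyOrdered C] [Infinite C] {lo hi F : Set C} (hlo : lo.Finite)
    (hhi : hi.Finite) (hF : F.Finite) (h : ∀ a ∈ lo, ∀ b ∈ hi, a < b)
    (htop : ∀ a ∈ lo, ¬ IsTop a) (hbot : ∀ b ∈ hi, ¬ IsBot b) :
    ∃ c ∉ F, (∀ a ∈ lo, a < c) ∧ ∀ b ∈ hi, c < b := by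
  have key : ∃ S : Set C, S.Infinite ∧ ∀ c ∈ S, (∀ a ∈ lo, a < c) ∧ ∀ b ∈ hi, c < b := by
    rcases lo.eq_empty_or_nonempty with rfl | hlo' <;>
      rcases hi.eq_empty_or_nonempty with rfl | hhi'
    · exact ⟨Set.univ, Set.infinite_univ, by simp⟩
    · obtain ⟨b, hb, hb'⟩ := hi.exists_min_image id hhi hhi'
      obtain ⟨a, ha⟩ := not_forall.1 (hbot b hb)
      exact ⟨Set.Ioo a b, Set.Ioo_infinite (not_le.1 ha), fun c hc =>
        ⟨by simp, fun x hx => hc.2.trans_le (hb' x hx)⟩⟩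
    · obtain ⟨a, ha, ha'⟩ := lo.exists_max_image id hlo hlo'
      obtain ⟨b, hb⟩ := not_forall.1 (htop a ha)
      exact ⟨Set.Ioo a b, Set.Ioo_infinite (not_le.1 hb), fun c hc =>
        ⟨fun x hx => (ha' x hx).trans_lt hc.1, by simp⟩⟩
    · obtain ⟨a, ha, ha'⟩ := lo.exists_max_image id hlo hlo'
      obtain ⟨b, hb, hb'⟩ := hi.exists_min_image id hhi hhi'
      exact ⟨Set.Ioo a b, Set.Ioo_infinite (h a ha b hb), fun c hc =>
        ⟨fun x hx => (ha' x hx).trans_lt hc.1, fun x hx => hc.2.trans_le (hb' x hx)⟩⟩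
  obtain ⟨S, hS, hS'⟩ := key
  obtain ⟨c, hc, hcF⟩ := hS.exists_notMem_finite hF
  exact ⟨c, hcF, hS' c hc⟩

/-- A finite strictly monotone map into an infinite dense order extends to finitely many more
points, with values outside a given finite set, provided that no new point has to go beyond an
endpoint of the order. -/
theorem exists_strictMonoOn_extend [DenselyOrdered C] [Infinite C] {P : Type w} [LinearOrder P]
    {A B : Set P} (hA : A.Finite) (hB : B.Finite) {F : Set C} (hF : F.Finite) (f : P → C)
    (hf : StrictMonoOn f A)
    (hend : ∀ p ∈ B, ∀ a ∈ A, (a < p → ¬ IsTop (f a)) ∧ (p < a → ¬ IsBot (f a))) :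
    ∃ e : P → C, StrictMonoOn e (A ∪ B) ∧ (∀ a ∈ A, e a = f a) ∧ ∀ p ∈ B, p ∉ A → e p ∉ F := by
  have htop : {c : C | IsTop c}.Finite :=
    Set.Subsingleton.finite fun a ha b hb => le_antisymm (hb a) (ha b)
  have hbot : {c : C | IsBot c}.Finite :=
    Set.Subsingleton.finite fun a ha b hb => le_antisymm (ha b) (hb a)
  -- new values are kept away from the endpoints, so that later points find room on both sides
  suffices h : ∃ e : P → C, StrictMonoOn e (A ∪ B) ∧ (∀ a ∈ A, e a = f a) ∧
      ∀ p ∈ B, p ∉ A → e p ∉ F ∪ ({c | IsTop c} ∪ {c | IsBot c}) by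
    obtain ⟨e, h₁, h₂, h₃⟩ := h
    exact ⟨e, h₁, h₂, fun p hp hpA hpF => h₃ p hp hpA (.inl hpF)⟩
  induction B, hB using Set.Finite.induction_on with
  | empty => exact ⟨f, by simpa using hf, fun _ _ => rfl, by simp⟩
  | @insert p B _ hB ih =>
    obtain ⟨e, h₁, h₂, h₃⟩ := ih fun q hq => hend q (.inr hq)
    by_cases hp : p ∈ A ∪ B
    · refine ⟨e, ?_, h₂, ?_⟩
      · rwa [Set.union_insert, Set.insert_eq_of_mem hp]
      · rintro q (rfl | hq) hqA
        · exact h₃ q (hp.resolve_left hqA) hqA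
        · exact h₃ q hq hqA
    have hAB := hA.union hB
    obtain ⟨c, hcF, hlo, hhi⟩ := exists_between_notMem
      (lo := e '' {a ∈ A ∪ B | a < p}) (hi := e '' {a ∈ A ∪ B | p < a})
      (F := F ∪ ({c | IsTop c} ∪ {c | IsBot c}))
      ((hAB.subset (Set.sep_subset _ _)).image _) ((hAB.subset (Set.sep_subset _ _)).image _)
      (hF.union (htop.union hbot))
      (by
        rintro _ ⟨a, ⟨ha, hap⟩, rfl⟩ _ ⟨b, ⟨hb, hpb⟩, rfl⟩
        exact h₁ ha hb (hap.trans hpb))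
      (by
        rintro _ ⟨a, ⟨ha, hap⟩, rfl⟩ htop
        by_cases haA : a ∈ A
        · rw [h₂ a haA] at htop
          exact (hend p (.inl rfl) a haA).1 hap htop
        · exact h₃ a (ha.resolve_left haA) haA (.inr (.inl htop)))
      (by
        rintro _ ⟨a, ⟨ha, hpa⟩, rfl⟩ hbot
        by_cases haA : a ∈ A
        · rw [h₂ a haA] at hbot
          exact (hend p (.inl rfl) a haA).2 hpa hbot
        · exact h₃ a (ha.resolve_left haA) haA (.inr (.inr hbot)))
    have hne : ∀ a ∈ A ∪ B, a ≠ p := by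
      rintro a ha rfl
      exact hp ha
    refine ⟨Function.update e p c, ?_, ?_, ?_⟩
    · rw [Set.union_insert]
      rintro a (rfl | ha) b (rfl | hb) hab
      · exact absurd hab (lt_irrefl _)
      · rw [Function.update_self, Function.update_of_ne (hne b hb)]
        exact hhi _ ⟨b, ⟨hb, hab⟩, rfl⟩
      · rw [Function.update_self, Function.update_of_ne (hne a ha)]
        exact hlo _ ⟨a, ⟨ha, hab⟩, rfl⟩
      · rw [Function.update_of_ne (hne a ha), Function.update_of_ne (hne b hb)]
        exact h₁ ha hb hab
    · intro a ha
      rw [Function.update_of_ne (hne a (.inl ha)), h₂ a ha]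
    · rintro q (rfl | hq) hqA
      · rwa [Function.update_self]
      · rw [Function.update_of_ne (hne q (.inr hq))]
        exact h₃ q hq hqA

/-- The maximum of two values, with the values themselves to break ties. -/
def mergeKey (a b : C) : C ×ₗ C ×ₗ C := toLex (max a b, toLex (a, b))

theorem mergeKey_le {a b a' b' : C} (h : a ≤ a') (h' : b ≤ b') :
    mergeKey a b ≤ mergeKey a' b' := by
  rw [mergeKey, mergeKey, Prod.Lex.toLex_le_toLex]
  rcases (max_le_max h h').lt_or_eq with h₁ | h₁
  · exact .inl h₁
  · refine .inr ⟨h₁, ?_⟩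
    rw [Prod.Lex.toLex_le_toLex]
    rcases h.lt_or_eq with h₂ | h₂
    · exact .inl h₂
    · exact .inr ⟨h₂, h'⟩

theorem mergeKey_inj {a b a' b' : C} :
    mergeKey a b = mergeKey a' b' ↔ a = a' ∧ b = b' := by
  constructor
  · intro h
    have h₁ : (max a b, toLex (a, b)) = (max a' b', toLex (a', b')) := h
    have h₂ : (a, b) = (a', b') := (Prod.mk.inj h₁).2
    exact Prod.mk.inj h₂
  · rintro ⟨rfl, rfl⟩
    rfl

theorem mergeKey_lt {a b a' b' : C} (h : a < a') (h' : b < b') :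
    mergeKey a b < mergeKey a' b' :=
  (mergeKey_le h.le h'.le).lt_of_ne fun e => h.ne (mergeKey_inj.1 e).1

theorem le_of_mergeKey_le {a b c : C} (h : mergeKey a b ≤ mergeKey c c) : a ≤ c ∧ b ≤ c := by
  rw [mergeKey, mergeKey, Prod.Lex.toLex_le_toLex] at h
  have : max a b ≤ max c c := by
    rcases h with h | h
    · exact le_of_lt h
    · exact le_of_eq h.1
  simpa using this

theorem Cmp.holds_mergeKey {θ : Cmp} {a b a' b' : C} (h : θ.Holds a a') (h' : θ.Holds b b') :
    θ.Holds (mergeKey a b) (mergeKey a' b') := by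
  cases θ with
  | lt => exact mergeKey_lt h h'
  | gt => exact mergeKey_lt h h'
  | le => exact mergeKey_le h h'
  | ge => exact mergeKey_le h h'
  | eq => exact mergeKey_inj.2 ⟨h, h'⟩
  | ne => exact fun e => h (mergeKey_inj.1 e).1

theorem Cmp.Holds.map {P : Type v} {P' : Type w} [LinearOrder P] [LinearOrder P'] {e : P → P'}
    {S : Set P} (he : StrictMonoOn e S) {θ : Cmp} {a b : P} (ha : a ∈ S) (hb : b ∈ S)
    (h : θ.Holds a b) : θ.Holds (e a) (e b) := by
  cases θ with
  | lt => exact he ha hb h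
  | gt => exact he hb ha h
  | le => exact he.monotoneOn ha hb h
  | ge => exact he.monotoneOn hb ha h
  | eq => exact congrArg e h
  | ne => exact he.injOn.ne ha hb h

/-- A binary operation that fixes the constants of `K`, preserves all comparisons on the finite set
`S` of pairs, and keeps whatever fails in one of its arguments among the equalities and the upper
bounds from `K`. -/
theorem exists_merge [DenselyOrdered C] [Infinite C] {K : Set C} (hK : K.Finite)
    {S : Set (C × C)} (hS : S.Finite) :
    ∃ m : C → C → C, (∀ c ∈ K, m c c = c) ∧
      (∀ p ∈ S ∪ (fun c => (c, c)) '' K, ∀ q ∈ S ∪ (fun c => (c, c)) '' K,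
        (∀ θ : Cmp, θ.Holds p.1 q.1 → θ.Holds p.2 q.2 → θ.Holds (m p.1 p.2) (m q.1 q.2)) ∧
        (m p.1 p.2 = m q.1 q.2 → p = q)) ∧
      ∀ p ∈ S, ∀ c ∈ K, m p.1 p.2 ≤ c → p.1 ≤ c ∧ p.2 ≤ c := by
  obtain ⟨e, h₁, h₂, -⟩ := exists_strictMonoOn_extend (C := C)
    (A := (fun c => mergeKey c c) '' K) (B := (fun p : C × C => mergeKey p.1 p.2) '' S)
    (hK.image _) (hS.image _) Set.finite_empty (fun p => (ofLex p).1)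
    (by
      rintro _ ⟨a, _, rfl⟩ _ ⟨b, _, rfl⟩ hab
      rcases lt_or_ge a b with h | h
      · simpa [mergeKey] using h
      · exact absurd (mergeKey_le h h) (not_le.2 hab))
    (by
      rintro _ ⟨p, _, rfl⟩ _ ⟨c, _, rfl⟩
      have hc : (ofLex (mergeKey c c)).1 = c := by simp [mergeKey]
      simp only [hc]
      exact ⟨fun h ht => absurd (mergeKey_le (ht p.1) (ht p.2)) (not_le.2 h),
        fun h hb => absurd (mergeKey_le (hb p.1) (hb p.2)) (not_le.2 h)⟩)
  have hfix : ∀ c ∈ K, e (mergeKey c c) = c := fun c hc => by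
    rw [h₂ _ ⟨c, hc, rfl⟩]; simp [mergeKey]
  have hmem : ∀ p ∈ S ∪ (fun c => (c, c)) '' K, mergeKey p.1 p.2 ∈
      (fun c => mergeKey c c) '' K ∪ (fun p : C × C => mergeKey p.1 p.2) '' S := by
    rintro p (hp | ⟨c, hc, rfl⟩)
    · exact .inr ⟨p, hp, rfl⟩
    · exact .inl ⟨c, hc, rfl⟩
  refine ⟨fun a b => e (mergeKey a b), hfix, fun p hp q hq => ⟨fun θ h h' => ?_, fun h => ?_⟩,
    fun p hp c hc h => ?_⟩
  · exact (Cmp.holds_mergeKey h h').map h₁ (hmem p hp) (hmem q hq)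
  · obtain ⟨h₃, h₄⟩ := mergeKey_inj.1 (h₁.injOn (hmem p hp) (hmem q hq) h)
    exact Prod.ext h₃ h₄
  · rw [← hfix c hc] at h
    exact le_of_mergeKey_le
      ((h₁.le_iff_le (hmem p (.inl hp)) (hmem (c, c) (.inr ⟨c, hc, rfl⟩))).1 h)

end

section

variable {C : Type u} [LinearOrder C] {R : Type v} {n : ℕ}

/-! ### Canonical databases -/

/-- The constants that occur in a query. -/
def CQAC.consts (Q : CQAC R C) : Set C :=
  {c | Term.const c ∈ Q.head} ∪ {c | ∃ a ∈ Q.body, Term.const c ∈ a.args} ∪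
    {c | ∃ b ∈ Q.acs, b.rhs = .const c}

theorem CQAC.finite_consts (Q : CQAC R C) : Q.consts.Finite := by
  have hinj : Function.Injective (Term.const : C → Term C) := fun _ _ h => Term.const.inj h
  have h (l : List (Term C)) : {c | Term.const c ∈ l}.Finite :=
    (List.finite_toSet l).preimage hinj.injOn
  refine ((h _).union ?_).union ?_
  · refine ((List.finite_toSet Q.body).biUnion fun a _ => h a.args).subset ?_
    rintro c ⟨a, ha, hc⟩
    exact Set.mem_biUnion (x := a) ha hc
  · refine (h (Q.acs.map (·.rhs))).subset ?_
    rintro c ⟨b, hb, hc⟩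
    exact List.mem_map.2 ⟨b, hb, hc⟩

theorem CQAC.const_mem_of_head {Q : CQAC R C} {c : C} (h : Term.const c ∈ Q.head) :
    c ∈ Q.consts := .inl (.inl h)

theorem CQAC.const_mem_of_body {Q : CQAC R C} {a : Atom R C} {c : C} (ha : a ∈ Q.body)
    (h : Term.const c ∈ a.args) : c ∈ Q.consts := .inl (.inr ⟨a, ha, h⟩)

theorem CQAC.const_mem_of_acs {Q : CQAC R C} {b : AC C} {c : C} (hb : b ∈ Q.acs)
    (h : b.rhs = .const c) : c ∈ Q.consts := .inr ⟨b, hb, h⟩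

/-- Evaluation in an arbitrary set of facts. -/
def CQAC.Ans (Q : CQAC R C) (D : Set (Fact R C)) (t : List C) : Prop :=
  ∃ h : ℕ → C, (∀ a ∈ Q.body, a.inst h ∈ D) ∧ (∀ b ∈ Q.acs, b.Holds h) ∧
    t = Q.head.map (Term.eval h)

theorem CQAC.Ans.mono {Q : CQAC R C} {D D' : Set (Fact R C)} {t : List C} (h : Q.Ans D t)
    (hD : D ⊆ D') : Q.Ans D' t := by
  obtain ⟨g, h₁, h₂⟩ := h
  exact ⟨g, fun a ha => hD (h₁ a ha), h₂⟩

variable (Q : CQAC R C) (V : Fin n → CQAC R C)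

/-- The assignment `h` of the variables of its view produces the view fact `f`. -/
def Solves (f : Fact (Fin n) C) (h : ℕ → C) : Prop :=
  f.2 = (V f.1).head.map (Term.eval h) ∧ ∀ b ∈ (V f.1).acs, b.Holds h

/-- The database that results from the view facts in `G` if each of them is unfolded along the
assignment that `H` chooses for it. -/
def canon (G : Set (Fact (Fin n) C)) (H : Fact (Fin n) C → ℕ → C) : Set (Fact R C) :=
  {x | ∃ f ∈ G, ∃ b ∈ (V f.1).body, x = b.inst (H f)}

theorem canon_mono {G G' : Set (Fact (Fin n) C)} (h : G ⊆ G') (H : Fact (Fin n) C → ℕ → C) :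
    canon V G H ⊆ canon V G' H := by
  rintro x ⟨f, hf, h'⟩
  exact ⟨f, h hf, h'⟩

theorem finite_canon {G : Set (Fact (Fin n) C)} (hG : G.Finite) (H : Fact (Fin n) C → ℕ → C) :
    (canon V G H).Finite := by
  refine (hG.biUnion fun f _ =>
    (List.finite_toSet (V f.1).body).image fun b => b.inst (H f)).subset ?_
  rintro x ⟨f, hf, b, hb, rfl⟩
  exact Set.mem_biUnion hf ⟨b, hb, rfl⟩

/-- By monotonicity, the canonical databases of all unfoldings suffice to compute the certain
answers. -/
theorem mem_certain_iff {I : Set (Fact (Fin n) C)} (hI : I.Finite) (t : List C) :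
    t ∈ certain Q V I ↔ ∀ H : Fact (Fin n) C → ℕ → C, (∀ f ∈ I, Solves V f (H f)) →
      Q.Ans (canon V I H) t := by
  classical
  simp only [certain, Set.mem_iInter]
  constructor
  · intro h H hH
    have := h (finite_canon V hI H).toFinset fun f hf =>
      ⟨H f, fun a ha => by simpa using ⟨f, hf, a, ha, rfl⟩, (hH f hf).2, (hH f hf).1⟩
    obtain ⟨g, h₁, h₂⟩ := this
    exact ⟨g, fun a ha => by simpa using h₁ a ha, h₂⟩
  · intro h D hD
    have hex : ∀ f : Fact (Fin n) C, ∃ h : ℕ → C, f ∈ I →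
        (∀ a ∈ (V f.1).body, a.inst h ∈ D) ∧ Solves V f h := by
      intro f
      by_cases hf : f ∈ I
      · obtain ⟨h, h₁, h₂, h₃⟩ := hD hf
        exact ⟨h, fun _ => ⟨h₁, h₃, h₂⟩⟩
      · obtain ⟨h, -⟩ := (V f.1).consistent
        exact ⟨h, fun hf' => absurd hf' hf⟩
    choose H hH using hex
    obtain ⟨g, h₁, h₂⟩ := h H fun f hf => (hH f hf).2
    refine ⟨g, fun a ha => ?_, h₂⟩
    obtain ⟨f, hf, b, hb, e⟩ := h₁ a ha
    rw [e]
    exact (hH f hf).1 b hb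

/-- The terms in the bodies of the views. -/
def viewTerms : List (Term C) :=
  (List.finRange n).flatMap fun i => (V i).body.flatMap fun a => a.args

variable {V} in
theorem mem_viewTerms {p : Term C} :
    p ∈ viewTerms V ↔ ∃ i, ∃ a ∈ (V i).body, p ∈ a.args := by
  simp [viewTerms]

/-- `K` contains all constants that occur in the query and in the views, and the endpoints of the
order, if there are any. -/
structure IsBase (K : Set C) : Prop where
  query : Q.consts ⊆ K
  view : ∀ i, (V i).consts ⊆ K
  top : ∀ c, IsTop c → c ∈ K
  bot : ∀ c, IsBot c → c ∈ K

theorem exists_isBase : ∃ K : Set C, K.Finite ∧ IsBase Q V K := by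
  refine ⟨Q.consts ∪ (⋃ i, (V i).consts) ∪ ({c | IsTop c} ∪ {c | IsBot c}), ?_, ?_, ?_, ?_, ?_⟩
  · refine (Q.finite_consts.union (Set.finite_iUnion fun i => (V i).finite_consts)).union
      (Set.Finite.union ?_ ?_)
    · exact Set.Subsingleton.finite fun a ha b hb => le_antisymm (hb a) (ha b)
    · exact Set.Subsingleton.finite fun a ha b hb => le_antisymm (ha b) (hb a)
  · exact fun c hc => .inl (.inl hc)
  · exact fun i c hc => .inl (.inr (Set.mem_iUnion.2 ⟨i, hc⟩))
  · exact fun c hc => .inr (.inl hc)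
  · exact fun c hc => .inr (.inr hc)

variable {Q V}

theorem IsBase.mono {K K' : Set C} (h : IsBase Q V K) (hK : K ⊆ K') : IsBase Q V K' :=
  ⟨h.query.trans hK, fun i => (h.view i).trans hK, fun c hc => hK (h.top c hc),
    fun c hc => hK (h.bot c hc)⟩

theorem IsBase.const_mem {K : Set C} (hK : IsBase Q V K) {c : C}
    (h : Term.const c ∈ viewTerms V) : c ∈ K := by
  obtain ⟨i, a, ha, hc⟩ := mem_viewTerms.1 h
  exact hK.view i (CQAC.const_mem_of_body ha hc)

/-! ### Replacing values -/

omit [LinearOrder C] in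
theorem eval_comp {e : C → C} {p : Term C} (h : ∀ c, p = .const c → e c = c) (g : ℕ → C) :
    p.eval (e ∘ g) = e (p.eval g) := by
  cases p with
  | var x => rfl
  | const c => exact (h c rfl).symm

omit [LinearOrder C] in
theorem map_eval_comp {e : C → C} {l : List (Term C)} (h : ∀ c, Term.const c ∈ l → e c = c)
    (g : ℕ → C) : l.map (Term.eval (e ∘ g)) = (l.map (Term.eval g)).map e := by
  rw [List.map_map]
  exact List.map_congr_left fun p hp => eval_comp (fun c hc => h c (hc ▸ hp)) g

omit [LinearOrder C] in
theorem inst_comp {e : C → C} {a : Atom R C} (h : ∀ c, Term.const c ∈ a.args → e c = c)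
    (g : ℕ → C) : a.inst (e ∘ g) = ((a.inst g).1, (a.inst g).2.map e) := by
  simp only [Atom.inst, map_eval_comp h]

theorem eval_mem_of_var {q : CQAC R C} {S : Set C} {g : ℕ → C}
    (hg : ∀ a ∈ q.body, ∀ p ∈ a.args, p.eval g ∈ S) {x : ℕ}
    (hx : ∃ a ∈ q.body, Term.var x ∈ a.args) : g x ∈ S := by
  obtain ⟨a, ha, hx⟩ := hx
  exact hg a ha _ hx

theorem holds_iff_le {b : AC C} {c : C} (hb : b.cmp = .le) (hc : b.rhs = .const c) (g : ℕ → C) :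
    b.Holds g ↔ g b.lhs ≤ c := by
  rw [AC.Holds, hb, hc]; rfl

theorem holds_iff_ge {b : AC C} {c : C} (hb : b.cmp = .ge) (hc : b.rhs = .const c) (g : ℕ → C) :
    b.Holds g ↔ c ≤ g b.lhs := by
  rw [AC.Holds, hb, hc]; rfl

/-- A map that is strictly monotone on all values and constants involved preserves the truth of the
comparisons of a query. -/
theorem holds_comp {q : CQAC R C} {S : Set C} {e : C → C} (he : StrictMonoOn e S)
    (hS : q.consts ⊆ S) (hfix : ∀ c ∈ q.consts, e c = c) {g : ℕ → C}
    (hg : ∀ a ∈ q.body, ∀ p ∈ a.args, p.eval g ∈ S) {b : AC C} (hb : b ∈ q.acs)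
    (h : b.Holds g) : b.Holds (e ∘ g) := by
  have h₁ : g b.lhs ∈ S := eval_mem_of_var hg (q.ac_safe b hb _ (.inl rfl))
  have h₂ : b.rhs.eval g ∈ S := by
    cases hr : b.rhs with
    | var x => exact eval_mem_of_var hg (q.ac_safe b hb x (.inr hr.symm))
    | const c => exact hS (CQAC.const_mem_of_acs hb hr)
  have h₃ := h.map he h₁ h₂
  unfold AC.Holds
  rwa [eval_comp fun c hc => hfix c (CQAC.const_mem_of_acs hb hc)]

theorem Solves.comp {f : Fact (Fin n) C} {h : ℕ → C} (hf : Solves V f h) {S : Set C} {e : C → C}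
    (he : StrictMonoOn e S) (hS : (V f.1).consts ⊆ S) (hfix : ∀ c ∈ (V f.1).consts, e c = c)
    (hh : ∀ a ∈ (V f.1).body, ∀ p ∈ a.args, p.eval h ∈ S) :
    Solves V (f.1, f.2.map e) (e ∘ h) := by
  refine ⟨?_, fun b hb => holds_comp he hS hfix hh hb (hf.2 b hb)⟩
  rw [map_eval_comp fun c hc => hfix c (CQAC.const_mem_of_head hc), hf.1]

theorem exists_leftInverse_of_strictMonoOn [Nonempty C] {S : Set C} {e : C → C}
    (he : StrictMonoOn e S) :
    ∃ r : C → C, StrictMonoOn r (e '' S) ∧ ∀ x ∈ S, r (e x) = x := by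
  have h : ∀ x ∈ S, Function.invFunOn e S (e x) = x := fun x hx =>
    he.injOn.leftInvOn_invFunOn hx
  refine ⟨Function.invFunOn e S, ?_, h⟩
  rintro _ ⟨a, ha, rfl⟩ _ ⟨b, hb, rfl⟩ hab
  rw [h a ha, h b hb]
  exact (he.lt_iff_lt ha hb).1 hab

/-- Certain answers contain no constants but those of the instance and of a base. -/
theorem mem_of_mem_certain [DenselyOrdered C] [Infinite C] {K : Set C} (hK : K.Finite)
    (hKb : IsBase Q V K) {I : Set (Fact (Fin n) C)} (hI : I.Finite)
    (hIK : ∀ f ∈ I, ∀ d ∈ f.2, d ∈ K) {H : Fact (Fin n) C → ℕ → C}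
    (hH : ∀ f ∈ I, Solves V f (H f)) {t : List C} (ht : t ∈ certain Q V I) :
    t.length = Q.head.length ∧ ∀ d ∈ t, d ∈ K := by
  rw [mem_certain_iff Q V hI] at ht
  -- move the values outside `K` away from the entries of `t`
  obtain ⟨e, h₁, h₂, h₃⟩ := exists_strictMonoOn_extend (C := C) (P := C) (A := K)
    (B := Set.image2 (fun f (p : Term C) => p.eval (H f)) I {p | p ∈ viewTerms V}) hK
    (hI.image2 _ (List.finite_toSet _)) (F := {d | d ∈ t}) (List.finite_toSet t) id
    (strictMono_id.strictMonoOn _)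
    (fun p _ a _ => ⟨fun h ht => absurd (ht p) (not_le.2 h),
      fun h hb => absurd (hb p) (not_le.2 h)⟩)
  have hval : ∀ f ∈ I, ∀ a ∈ (V f.1).body, ∀ p ∈ a.args, p.eval (H f) ∈
      Set.image2 (fun f (p : Term C) => p.eval (H f)) I {p | p ∈ viewTerms V} :=
    fun f hf a ha p hp => ⟨f, hf, p, mem_viewTerms.2 ⟨_, a, ha, hp⟩, rfl⟩
  have hfix : ∀ c ∈ K, e c = c := h₂
  obtain ⟨g, hg, -, rfl⟩ := ht (fun f => e ∘ H f) fun f hf => by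
    have := (hH f hf).comp h₁ ((hKb.view _).trans Set.subset_union_left)
      (fun c hc => hfix c (hKb.view _ hc)) fun a ha p hp => .inr (hval f hf a ha p hp)
    rwa [List.map_congr_left fun d hd => hfix d (hIK f hf d hd), List.map_id'] at this
  refine ⟨by simp, fun d hd => ?_⟩
  obtain ⟨p, hp, rfl⟩ := List.mem_map.1 hd
  cases p with
  | const c => exact hKb.query (CQAC.const_mem_of_head hp)
  | var x =>
    obtain ⟨a, ha, hxa⟩ := Q.head_safe x hp
    obtain ⟨f, hf, b, hb, hab⟩ := hg a ha
    have hx : g x ∈ (a.inst g).2 := List.mem_map.2 ⟨_, hxa, rfl⟩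
    rw [hab] at hx
    obtain ⟨p, hpb, hpx⟩ := List.mem_map.1 hx
    rw [eval_comp fun c hc => hfix c (hKb.view _ (CQAC.const_mem_of_body hb (hc ▸ hpb)))] at hpx
    change g x ∈ K
    by_contra hxK
    by_cases hpK : p.eval (H f) ∈ K
    · rw [hfix _ hpK] at hpx
      exact hxK (hpx ▸ hpK)
    · exact h₃ _ (hval f hf b hb p hpb) hpK (by rw [hpx]; exact hd)

end

section

variable {C : Type u} [LinearOrder C] {R : Type v} {n : ℕ}

/-! ### Propagation of upper bounds -/

/-- A literal `(f, p)` says of the term `p` in the unfolding of the view fact `f` that its value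
violates the right semi-interval comparison of the query. -/
abbrev Lit (n : ℕ) (C : Type u) := Fact (Fin n) C × Term C

variable (Q : CQAC R C) (V : Fin n → CQAC R C)

/-- The value `v` violates a right semi-interval comparison of the query. -/
def Low (v : C) : Prop := ∃ b ∈ Q.acs, b.cmp = .ge ∧ ∃ c, b.rhs = .const c ∧ v < c

/-- The assignments `H` produce the view facts in `G` and make the literals in `w` true. -/
def Sat (G : Set (Fact (Fin n) C)) (w : Set (Lit n C)) (H : Fact (Fin n) C → ℕ → C) : Prop :=
  (∀ f ∈ G, Solves V f (H f)) ∧ ∀ ℓ ∈ w, Low Q (ℓ.2.eval (H ℓ.1))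

/-- Every unfolding of `G` that makes the literals in `w` true yields the answer `t` or makes the
literal `o` true (if there is one). -/
def Entails (t : List C) (G : List (Fact (Fin n) C)) (w : List (Lit n C))
    (o : Option (Lit n C)) : Prop :=
  ∀ H, Sat Q V {f | f ∈ G} {ℓ | ℓ ∈ w} H →
    Q.Ans (canon V {f | f ∈ G} H) t ∨ ∃ ℓ ∈ o, Low Q (ℓ.2.eval (H ℓ.1))

/-- The number of view facts that one application of a rule inspects: one for each atom of the query,
and at least one, so that literals that contradict a view fact are noticed. -/
def numFacts : ℕ := Q.body.length + 1

/-- The number of literals that one application of a rule inspects: all literals about `numFacts`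
facts. -/
def numLits : ℕ := numFacts Q * (viewTerms V).length

/-- The conclusion `o` follows from at most `numFacts` facts of `I` and at most `numLits` literals
of `D`. -/
def Derives (t : List C) (I : Set (Fact (Fin n) C)) (D : Set (Lit n C)) (o : Option (Lit n C)) :
    Prop :=
  ∃ G : List (Fact (Fin n) C), G.length ≤ numFacts Q ∧ (∀ f ∈ G, f ∈ I) ∧
    ∃ w : List (Lit n C), w.length ≤ numLits Q V ∧ (∀ ℓ ∈ w, ℓ ∈ D) ∧ Entails Q V t G w o

/-- The literals derivable in one step. -/
def deriveStep (t : List C) (I : Set (Fact (Fin n) C)) (D : Set (Lit n C)) : Set (Lit n C) :=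
  {ℓ | ℓ.1 ∈ I ∧ ℓ.2 ∈ viewTerms V ∧ Derives Q V t I D (some ℓ)}

variable {Q V}

theorem Derives.mono {t : List C} {I : Set (Fact (Fin n) C)} {D D' : Set (Lit n C)}
    {o : Option (Lit n C)} (h : Derives Q V t I D o) (hD : D ⊆ D') : Derives Q V t I D' o := by
  obtain ⟨G, hG, hGI, w, hw, hwD, h⟩ := h
  exact ⟨G, hG, hGI, w, hw, fun ℓ hℓ => hD (hwD ℓ hℓ), h⟩

theorem deriveStep_mono (t : List C) (I : Set (Fact (Fin n) C)) :
    Monotone (deriveStep Q V t I) :=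
  fun _ _ hD _ hℓ => ⟨hℓ.1, hℓ.2.1, hℓ.2.2.mono hD⟩

theorem deriveStep_subset {t : List C} {I : Set (Fact (Fin n) C)} {D : Set (Lit n C)} :
    deriveStep Q V t I D ⊆ {ℓ | ℓ.1 ∈ I ∧ ℓ.2 ∈ viewTerms V} :=
  fun _ h => ⟨h.1, h.2.1⟩

/-- A conclusion holds in every unfolding without the answer `t` in which its premises hold. -/
theorem Derives.sound {t : List C} {I : Set (Fact (Fin n) C)} {D : Set (Lit n C)}
    {o : Option (Lit n C)} (h : Derives Q V t I D o) {H : Fact (Fin n) C → ℕ → C}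
    (hH : ∀ f ∈ I, Solves V f (H f)) (ht : ¬ Q.Ans (canon V I H) t)
    (hD : ∀ ℓ ∈ D, Low Q (ℓ.2.eval (H ℓ.1))) : ∃ ℓ ∈ o, Low Q (ℓ.2.eval (H ℓ.1)) := by
  obtain ⟨G, -, hGI, w, -, hwD, h⟩ := h
  refine (h H ⟨fun f hf => hH f (hGI f hf), fun ℓ hℓ => hD ℓ (hwD ℓ hℓ)⟩).resolve_left fun h => ?_
  exact ht (h.mono (canon_mono V hGI H))

/-- If a family is closed under an operation that keeps the failures of both arguments, then it has
a generic member: one in which only those properties hold that hold throughout. -/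
theorem exists_generic {X : Type*} {S : Set X} (hS : S.Nonempty) {P : Set (Set X)} (hP : P.Finite)
    (h : ∀ g ∈ S, ∀ h ∈ S, ∃ m ∈ S, ∀ p ∈ P, m ∈ p → g ∈ p ∧ h ∈ p) :
    ∃ m ∈ S, ∀ p ∈ P, m ∈ p → S ⊆ p := by
  suffices H : ∀ P' : Set (Set X), P'.Finite → P' ⊆ P → ∃ m ∈ S, ∀ p ∈ P', m ∈ p → S ⊆ p from
    H P hP subset_rfl
  intro P' hP'
  induction P', hP' using Set.Finite.induction_on with
  | empty =>
    obtain ⟨m, hm⟩ := hS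
    exact fun _ => ⟨m, hm, by simp⟩
  | @insert p P' _ _ ih =>
    intro hsub
    obtain ⟨g, hg, hg'⟩ := ih fun q hq => hsub (.inr hq)
    by_cases hp : S ⊆ p
    · refine ⟨g, hg, ?_⟩
      rintro q (rfl | hq) hgq
      · exact hp
      · exact hg' q hq hgq
    · obtain ⟨k, hk, hkp⟩ := Set.not_subset.1 hp
      obtain ⟨m, hm, hm'⟩ := h g hg k hk
      refine ⟨m, hm, ?_⟩
      rintro q (rfl | hq) hmq
      · exact absurd (hm' q (hsub (.inl rfl)) hmq).2 hkp
      · exact hg' q hq (hm' q (hsub (.inr hq)) hmq).1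

/-- Two unfoldings merge into one in which no equality and no upper bound holds that fails in one of
them. -/
theorem Sat.exists_merge [DenselyOrdered C] [Infinite C] (hQ : Q.IsClosedRSI1) {K : Set C}
    (hK : K.Finite) (hKb : IsBase Q V K) {I : Set (Fact (Fin n) C)} (hI : I.Finite)
    (hIK : ∀ f ∈ I, ∀ d ∈ f.2, d ∈ K) {D : Set (Lit n C)}
    (hD : D ⊆ {ℓ | ℓ.1 ∈ I ∧ ℓ.2 ∈ viewTerms V}) {G H : Fact (Fin n) C → ℕ → C}
    (hG : Sat Q V I D G) (hH : Sat Q V I D H) :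
    ∃ M, Sat Q V I D M ∧ ∀ u : Lit n C, u.1 ∈ I → u.2 ∈ viewTerms V →
      (∀ v : Lit n C, v.1 ∈ I → v.2 ∈ viewTerms V → u.2.eval (M u.1) = v.2.eval (M v.1) →
        u.2.eval (G u.1) = v.2.eval (G v.1) ∧ u.2.eval (H u.1) = v.2.eval (H v.1)) ∧
      (∀ c ∈ K, u.2.eval (M u.1) = c → u.2.eval (G u.1) = c ∧ u.2.eval (H u.1) = c) ∧
      ∀ c ∈ K, u.2.eval (M u.1) ≤ c → u.2.eval (G u.1) ≤ c ∧ u.2.eval (H u.1) ≤ c := by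
  let S : Set (C × C) := Set.image2 (fun f (p : Term C) => (p.eval (G f), p.eval (H f))) I
    {p | p ∈ viewTerms V}
  obtain ⟨m, hm, hm₁, hm₂⟩ := CertainAnswers.exists_merge hK (S := S)
    (hI.image2 _ (List.finite_toSet _))
  let M : Fact (Fin n) C → ℕ → C := fun f x => m (G f x) (H f x)
  have hS : ∀ f ∈ I, ∀ p ∈ viewTerms V, (p.eval (G f), p.eval (H f)) ∈ S :=
    fun f hf p hp => ⟨f, hf, p, hp, rfl⟩
  have hM : ∀ f (p : Term C), (∀ c, p = .const c → c ∈ K) →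
      p.eval (M f) = m (p.eval (G f)) (p.eval (H f)) := by
    intro f p hp
    cases p with
    | var x => rfl
    | const c => exact (hm c (hp c rfl)).symm
  have hM' : ∀ f, ∀ p ∈ viewTerms V, p.eval (M f) = m (p.eval (G f)) (p.eval (H f)) :=
    fun f p hp => hM f p fun c hc => hKb.const_mem (hc ▸ hp)
  have hKS : ∀ c ∈ K, (c, c) ∈ S ∪ (fun c => (c, c)) '' K := fun c hc => .inr ⟨c, hc, rfl⟩
  refine ⟨M, ⟨fun f hf => ⟨?_, fun b hb => ?_⟩, fun ℓ hℓ => ?_⟩, fun u hu hu' => ⟨?_, ?_, ?_⟩⟩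
  · have h₁ := (hG.1 f hf).1
    have h₂ := (hH.1 f hf).1
    conv_lhs => rw [h₁]
    refine List.map_congr_left fun p hp => ?_
    have h₃ : p.eval (G f) = p.eval (H f) := List.map_inj_left.1 (h₁.symm.trans h₂) p hp
    rw [hM f p fun c hc => hKb.view _ (CQAC.const_mem_of_head (hc ▸ hp)), ← h₃, hm]
    exact hIK f hf _ (by rw [h₁]; exact List.mem_map.2 ⟨p, hp, rfl⟩)
  · have hvar : ∀ x, (∃ a ∈ (V f.1).body, Term.var x ∈ a.args) → Term.var x ∈ viewTerms V :=
      fun x ⟨a, ha, hx⟩ => mem_viewTerms.2 ⟨_, a, ha, hx⟩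
    have h₁ : (G f b.lhs, H f b.lhs) ∈ S :=
      hS f hf (.var b.lhs) (hvar _ ((V f.1).ac_safe b hb _ (.inl rfl)))
    have hc : ∀ c, b.rhs = .const c → c ∈ K :=
      fun c hc => hKb.view _ (CQAC.const_mem_of_acs hb hc)
    have h₂ : (b.rhs.eval (G f), b.rhs.eval (H f)) ∈ S ∪ (fun c => (c, c)) '' K := by
      cases hr : b.rhs with
      | var x => exact .inl (hS f hf (.var x) (hvar x ((V f.1).ac_safe b hb x (.inr hr.symm))))
      | const c => exact hKS c (hc c hr)
    have := (hm₁ _ (.inl h₁) _ h₂).1 b.cmp ((hG.1 f hf).2 b hb) ((hH.1 f hf).2 b hb)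
    unfold AC.Holds
    rwa [hM f b.rhs hc]
  · obtain ⟨b, hb, hge, c, hc, h⟩ := hG.2 ℓ hℓ
    obtain ⟨b', hb', hge', c', hc', h'⟩ := hH.2 ℓ hℓ
    -- both bounds come from the same comparison, since there is only one
    obtain rfl := hQ.2 b hb b' hb' ⟨hge, c, hc⟩ ⟨hge', c', hc'⟩
    obtain rfl : c = c' := Term.const.inj (hc.symm.trans hc')
    have hcK : c ∈ K := hKb.query (CQAC.const_mem_of_acs hb hc)
    refine ⟨b, hb, hge, c, hc, ?_⟩
    have := (hm₁ _ (.inl (hS _ (hD hℓ).1 _ (hD hℓ).2)) _ (hKS c hcK)).1 .lt h h'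
    rw [hM' _ _ (hD hℓ).2]
    exact lt_of_lt_of_eq this (hm c hcK)
  · intro v hv hv' h
    rw [hM' _ _ hu', hM' _ _ hv'] at h
    exact Prod.mk.inj ((hm₁ _ (.inl (hS _ hu _ hu')) _ (.inl (hS _ hv _ hv'))).2 h)
  · intro c hc h
    rw [hM' _ _ hu'] at h
    exact Prod.mk.inj ((hm₁ _ (.inl (hS _ hu _ hu')) _ (hKS c hc)).2 (h.trans (hm c hc).symm))
  · intro c hc h
    rw [hM' _ _ hu'] at h
    exact hm₂ _ (hS _ hu _ hu') c hc h

/-- There is an unfolding that is generic among those in which the literals of `D` are true: its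
values map to those of any other one, and upper bounds are kept. -/
theorem Sat.exists_generic [DenselyOrdered C] [Infinite C] (hQ : Q.IsClosedRSI1) {K : Set C}
    (hK : K.Finite) (hKb : IsBase Q V K) {I : Set (Fact (Fin n) C)} (hI : I.Finite)
    (hIK : ∀ f ∈ I, ∀ d ∈ f.2, d ∈ K) {D : Set (Lit n C)}
    (hD : D ⊆ {ℓ | ℓ.1 ∈ I ∧ ℓ.2 ∈ viewTerms V}) (hne : ∃ H, Sat Q V I D H) :
    ∃ M, Sat Q V I D M ∧ ∀ H, Sat Q V I D H → ∃ ψ : C → C, (∀ c ∈ K, ψ c = c) ∧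
      ∀ f ∈ I, ∀ p ∈ viewTerms V, ψ (p.eval (M f)) = p.eval (H f) ∧
        ∀ c ∈ K, p.eval (M f) ≤ c → p.eval (H f) ≤ c := by
  classical
  let T : Set (Lit n C) := I ×ˢ {p | p ∈ viewTerms V}
  have hT : T.Finite := hI.prod (List.finite_toSet _)
  let ev : (Fact (Fin n) C → ℕ → C) → Lit n C → C := fun H u => u.2.eval (H u.1)
  obtain ⟨M, hM, hgen⟩ := CertainAnswers.exists_generic (S := {H | Sat Q V I D H}) hne
    (P := Set.image2 (fun u v => {H | ev H u = ev H v}) T T ∪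
      (Set.image2 (fun u c => {H | ev H u = c}) T K ∪
        Set.image2 (fun u c => {H | ev H u ≤ c}) T K))
    ((hT.image2 _ hT).union ((hT.image2 _ hK).union (hT.image2 _ hK)))
    (by
      intro G hG H hH
      obtain ⟨M, hM, h⟩ := Sat.exists_merge hQ hK hKb hI hIK hD hG hH
      refine ⟨M, hM, ?_⟩
      rintro _ (⟨u, hu, v, hv, rfl⟩ | ⟨u, hu, c, hc, rfl⟩ | ⟨u, hu, c, hc, rfl⟩) hp
      · exact (h u hu.1 hu.2).1 v hv.1 hv.2 hp
      · exact (h u hu.1 hu.2).2.1 c hc hp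
      · exact (h u hu.1 hu.2).2.2 c hc hp)
  refine ⟨M, hM, fun H hH => ?_⟩
  have h₁ : ∀ u ∈ T, ∀ v ∈ T, ev M u = ev M v → ev H u = ev H v :=
    fun u hu v hv h => hgen _ (.inl ⟨u, hu, v, hv, rfl⟩) h hH
  have h₂ : ∀ u ∈ T, ∀ c ∈ K, ev M u = c → ev H u = c :=
    fun u hu c hc h => hgen _ (.inr (.inl ⟨u, hu, c, hc, rfl⟩)) h hH
  have h₃ : ∀ u ∈ T, ∀ c ∈ K, ev M u ≤ c → ev H u ≤ c :=
    fun u hu c hc h => hgen _ (.inr (.inr ⟨u, hu, c, hc, rfl⟩)) h hH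
  refine ⟨fun d => if h : ∃ u ∈ T, ev M u = d then ev H h.choose else d, fun c hc => ?_,
    fun f hf p hp => ⟨?_, h₃ (f, p) ⟨hf, hp⟩⟩⟩
  · dsimp only
    split_ifs with h
    · exact h₂ _ h.choose_spec.1 c hc h.choose_spec.2
    · rfl
  · have h : ∃ u ∈ T, ev M u = p.eval (M f) := ⟨(f, p), ⟨hf, hp⟩, rfl⟩
    dsimp only
    rw [dif_pos h]
    exact h₁ _ h.choose_spec.1 (f, p) ⟨hf, hp⟩ h.choose_spec.2

/-- If a set of literals is closed under derivation and does not derive the answer `t`, then `t` is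
refuted by a generic unfolding. -/
theorem exists_not_ans [DenselyOrdered C] [Infinite C] (hQ : Q.IsClosedRSI1) {K : Set C}
    (hK : K.Finite) (hKb : IsBase Q V K) {I : Set (Fact (Fin n) C)} (hI : I.Finite)
    (hIK : ∀ f ∈ I, ∀ d ∈ f.2, d ∈ K) {t : List C} (htK : ∀ d ∈ t, d ∈ K) {D : Set (Lit n C)}
    (hD : D ⊆ {ℓ | ℓ.1 ∈ I ∧ ℓ.2 ∈ viewTerms V}) (hclosed : deriveStep Q V t I D ⊆ D)
    (hgoal : ¬ Derives Q V t I D none) :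
    ∃ H, (∀ f ∈ I, Solves V f (H f)) ∧ ¬ Q.Ans (canon V I H) t := by
  classical
  -- all literals about the facts in `G` fit into one application of a rule
  have hlits : ∀ G : List (Fact (Fin n) C), G.length ≤ numFacts Q → (∀ f ∈ G, f ∈ I) →
      ∀ o, Entails Q V t G ((G ×ˢ viewTerms V).filter (· ∈ D)) o → Derives Q V t I D o := by
    intro G hG hGI o h
    refine ⟨G, hG, hGI, _, (List.length_filter_le _ _).trans ?_, fun ℓ hℓ => ?_, h⟩
    · rw [List.length_product]
      exact Nat.mul_le_mul_right _ hG
    · simpa using (List.mem_filter.1 hℓ).2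
  have hmem : ∀ G : List (Fact (Fin n) C), ∀ ℓ ∈ D, ℓ.1 ∈ G →
      ℓ ∈ (G ×ˢ viewTerms V).filter (· ∈ D) := by
    intro G ℓ hℓ hG
    exact List.mem_filter.2 ⟨List.mem_product.2 ⟨hG, (hD hℓ).2⟩, by simpa using hℓ⟩
  have hne : ∃ H, Sat Q V I D H := by
    have : ∀ f, ∃ h : ℕ → C, f ∈ I →
        Solves V f h ∧ ∀ p, (f, p) ∈ D → Low Q (p.eval h) := by
      intro f
      by_contra! hf
      obtain ⟨h₀, -⟩ := Q.consistent
      refine hgoal (hlits [f] (by simp [numFacts]) (by simpa using (hf h₀).1) none fun H hH => ?_)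
      obtain ⟨-, h⟩ := hf (H f)
      obtain ⟨p, hp, hp'⟩ := h (hH.1 f (by simp))
      exact absurd (hH.2 (f, p) (hmem [f] _ hp (by simp))) hp'
    choose H hH using this
    exact ⟨H, fun f hf => (hH f hf).1, fun ℓ hℓ => (hH ℓ.1 (hD hℓ).1).2 ℓ.2 hℓ⟩
  obtain ⟨M, hM, hgen⟩ := Sat.exists_generic hQ hK hKb hI hIK hD hne
  refine ⟨M, hM.1, ?_⟩
  rintro ⟨g, hg, hacs, ht⟩
  choose F hF b hb hab using hg
  let G : List (Fact (Fin n) C) := Q.body.attach.map fun a => F a.1 a.2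
  have hG : G.length ≤ numFacts Q := by simp [G, numFacts]
  have hFG : ∀ a ha, F a ha ∈ G := fun a ha => List.mem_map.2 ⟨⟨a, ha⟩, by simp, rfl⟩
  have hGI : ∀ f ∈ G, f ∈ I := by
    intro f hf
    obtain ⟨a, -, rfl⟩ := List.mem_map.1 hf
    exact hF _ _
  -- the position in the unfoldings to which a variable of the query is mapped
  have hpos : ∀ x, (∃ a ∈ Q.body, Term.var x ∈ a.args) →
      ∃ f ∈ G, ∃ p ∈ viewTerms V, g x = p.eval (M f) := by
    rintro x ⟨a, ha, hx⟩
    have hx' : g x ∈ (a.inst g).2 := List.mem_map.2 ⟨_, hx, rfl⟩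
    rw [hab a ha] at hx'
    obtain ⟨p, hp, hpx⟩ := List.mem_map.1 hx'
    exact ⟨F a ha, hFG a ha, p, mem_viewTerms.2 ⟨_, _, hb a ha, hp⟩, hpx.symm⟩
  -- the match carries over to every other unfolding, except for the lower bound
  have htransfer : ∀ H, Sat Q V {f | f ∈ G} {ℓ | ℓ ∈ (G ×ˢ viewTerms V).filter (· ∈ D)} H →
      ∃ ψ : C → C, (∀ f ∈ G, ∀ p ∈ viewTerms V, ψ (p.eval (M f)) = p.eval (H f)) ∧
        ((∀ b ∈ Q.acs, b.IsClosedRSI → b.Holds (ψ ∘ g)) → Q.Ans (canon V {f | f ∈ G} H) t) := by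
    intro H hH
    let H' : Fact (Fin n) C → ℕ → C := fun f => if f ∈ G then H f else M f
    have hH'G : ∀ f ∈ G, H' f = H f := fun f hf => if_pos hf
    have hH' : Sat Q V I D H' := by
      refine ⟨fun f hf => ?_, fun ℓ hℓ => ?_⟩
      · by_cases hfG : f ∈ G
        · rw [hH'G f hfG]; exact hH.1 f hfG
        · rw [show H' f = M f from if_neg hfG]; exact hM.1 f hf
      · by_cases hfG : ℓ.1 ∈ G
        · rw [hH'G _ hfG]; exact hH.2 ℓ (hmem G ℓ hℓ hfG)
        · rw [show H' ℓ.1 = M ℓ.1 from if_neg hfG]; exact hM.2 ℓ hℓ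
    obtain ⟨ψ, hψ, hψ'⟩ := hgen H' hH'
    refine ⟨ψ, fun f hf p hp => by rw [(hψ' f (hGI f hf) p hp).1, hH'G f hf], fun hrsi => ?_⟩
    refine ⟨ψ ∘ g, fun a ha => ⟨F a ha, hFG a ha, b a ha, hb a ha, ?_⟩, fun e he => ?_, ?_⟩
    · rw [inst_comp fun c hc => hψ c (hKb.query (CQAC.const_mem_of_body ha hc)), hab a ha]
      simp only [Atom.inst, List.map_map]
      congr 1
      refine List.map_congr_left fun p hp => ?_
      rw [Function.comp_apply,
        (hψ' _ (hF a ha) p (mem_viewTerms.2 ⟨_, _, hb a ha, hp⟩)).1, hH'G _ (hFG a ha)]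
    · rcases hQ.1 e he with ⟨hle, c, hc⟩ | h
      · have hcK := hKb.query (CQAC.const_mem_of_acs he hc)
        obtain ⟨f, hf, p, hp, hgp⟩ := hpos e.lhs (Q.ac_safe e he _ (.inl rfl))
        have h := hacs e he
        rw [holds_iff_le hle hc, hgp] at h
        rw [holds_iff_le hle hc, Function.comp_apply, hgp]
        obtain ⟨h₁, h₂⟩ := hψ' f (hGI f hf) p hp
        rw [h₁]
        exact h₂ c hcK h
      · exact hrsi e he h
    · rw [map_eval_comp fun c hc => hψ c (hKb.query (CQAC.const_mem_of_head hc)), ← ht,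
        List.map_congr_left fun d hd => hψ d (htK d hd), List.map_id']
  by_cases hex : ∃ e ∈ Q.acs, e.IsClosedRSI
  · obtain ⟨e, he, hge, c, hc⟩ := hex
    obtain ⟨f, hf, p, hp, hgp⟩ := hpos e.lhs (Q.ac_safe e he _ (.inl rfl))
    have hℓ : (f, p) ∈ D := by
      refine hclosed ⟨hGI f hf, hp, hlits G hG hGI _ fun H hH => ?_⟩
      obtain ⟨ψ, hψ, hans⟩ := htransfer H hH
      by_cases hlow : p.eval (H f) < c
      · exact .inr ⟨_, rfl, e, he, hge, c, hc, hlow⟩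
      · refine .inl (hans fun e' he' h' => ?_)
        obtain rfl := hQ.2 e he e' he' ⟨hge, c, hc⟩ h'
        rw [holds_iff_ge hge hc, Function.comp_apply, hgp, hψ f hf p hp]
        exact not_lt.1 hlow
    obtain ⟨e', he', hge', c', hc', hlow⟩ := hM.2 _ hℓ
    obtain rfl := hQ.2 e he e' he' ⟨hge, c, hc⟩ ⟨hge', c', hc'⟩
    obtain rfl : c = c' := Term.const.inj (hc.symm.trans hc')
    have h := hacs e he
    rw [holds_iff_ge hge hc, hgp] at h
    exact absurd hlow (not_lt.2 h)
  · push Not at hex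
    refine hgoal (hlits G hG hGI none fun H hH => .inl ?_)
    obtain ⟨ψ, -, hans⟩ := htransfer H hH
    exact hans fun e he h => absurd h (hex e he)

/-- The constants of a view fact replaced along `σ`. -/
def factMap (σ : C → C) (f : Fact (Fin n) C) : Fact (Fin n) C := (f.1, f.2.map σ)

/-- The constants of the view fact of a literal replaced along `σ`. -/
def litMap (σ : C → C) (ℓ : Lit n C) : Lit n C := (factMap σ ℓ.1, ℓ.2)

/-- Entailment depends only on the order of the constants. -/
theorem Entails.map [DenselyOrdered C] [Infinite C] {K A : Set C} (hKb : IsBase Q V K)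
    (hA : A.Finite) (hKA : K ⊆ A) {σ : C → C} (hσ : StrictMonoOn σ A) (hσK : ∀ c ∈ K, σ c = c)
    {t : List C} {G : List (Fact (Fin n) C)} {w : List (Lit n C)} {o : Option (Lit n C)}
    (htA : ∀ d ∈ t, d ∈ A) (hGA : ∀ f ∈ G, ∀ d ∈ f.2, d ∈ A)
    (hw : ∀ ℓ ∈ w, ℓ.2 ∈ viewTerms V) (ho : ∀ ℓ ∈ o, ℓ.2 ∈ viewTerms V)
    (h : Entails Q V t G w o) :
    Entails Q V (t.map σ) (G.map (factMap σ)) (w.map (litMap σ)) (o.map (litMap σ)) := by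
  intro H hH
  obtain ⟨r, hr, hrσ⟩ := exists_leftInverse_of_strictMonoOn hσ
  let B : Set C := Set.image2 (fun f (p : Term C) => p.eval (H f))
    ({f | f ∈ G.map (factMap σ)} ∪ ({f | ∃ ℓ ∈ w.map (litMap σ), f = ℓ.1} ∪
      {f | ∃ ℓ ∈ o.map (litMap σ), f = ℓ.1})) {p | p ∈ viewTerms V}
  have hB : B.Finite := by
    refine Set.Finite.image2 _ ((List.finite_toSet _).union (.union ?_ ?_)) (List.finite_toSet _)
    · refine ((List.finite_toSet (w.map (litMap σ))).image Prod.fst).subset ?_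
      rintro f ⟨ℓ, hℓ, rfl⟩
      exact ⟨ℓ, hℓ, rfl⟩
    · refine Set.Subsingleton.finite ?_
      rintro f ⟨ℓ, hℓ, rfl⟩ f' ⟨ℓ', hℓ', rfl⟩
      rw [Option.mem_unique hℓ hℓ']
  obtain ⟨e, he, heA, -⟩ := exists_strictMonoOn_extend (hA.image σ) hB Set.finite_empty r hr (by
    rintro p - _ ⟨a, ha, rfl⟩
    rw [hrσ a ha]
    constructor
    · intro hap htop
      rw [hσK a (hKb.top a htop)] at hap
      exact absurd (htop p) (not_le.2 hap)
    · intro hpa hbot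
      rw [hσK a (hKb.bot a hbot)] at hpa
      exact absurd (hbot p) (not_le.2 hpa))
  have heσ : ∀ a ∈ A, e (σ a) = a := fun a ha => (heA _ ⟨a, ha, rfl⟩).trans (hrσ a ha)
  have heK : ∀ c ∈ K, e c = c := fun c hc => by
    conv_lhs => rw [← hσK c hc]
    exact heσ c (hKA hc)
  have hKS : K ⊆ σ '' A ∪ B := fun c hc => .inl ⟨c, hKA hc, hσK c hc⟩
  obtain ⟨ρ, hρ, hρe⟩ := exists_leftInverse_of_strictMonoOn he
  have hρK : ∀ c ∈ K, ρ c = c := fun c hc => by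
    conv_lhs => rw [← heK c hc]
    exact hρe c (hKS hc)
  -- the unfolding of the original facts that corresponds to `H`
  let H' : Fact (Fin n) C → ℕ → C := fun f => e ∘ H (factMap σ f)
  have hev : ∀ f, ∀ p ∈ viewTerms V, p.eval (H' f) = e (p.eval (H (factMap σ f))) :=
    fun f p hp => eval_comp (fun c hc => heK c (hKb.const_mem (hc ▸ hp))) _
  have hlow : ∀ v ∈ B, Low Q (e v) ↔ Low Q v := by
    intro v hv
    refine exists_congr fun b => and_congr_right fun hb => and_congr_right fun _ =>
      exists_congr fun c => and_congr_right fun hc => ?_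
    have hcK := hKb.query (CQAC.const_mem_of_acs hb hc)
    conv_lhs => rw [← heK c hcK]
    exact he.lt_iff_lt (.inr hv) (hKS hcK)
  have hGB : ∀ f ∈ G, ∀ p ∈ viewTerms V, p.eval (H (factMap σ f)) ∈ B :=
    fun f hf p hp => ⟨_, .inl (List.mem_map_of_mem hf), p, hp, rfl⟩
  have hH' : Sat Q V {f | f ∈ G} {ℓ | ℓ ∈ w} H' := by
    refine ⟨fun f hf => ?_, fun ℓ hℓ => ?_⟩
    · have := (hH.1 (factMap σ f) (List.mem_map_of_mem hf)).comp he ((hKb.view _).trans hKS)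
        (fun c hc => heK c (hKb.view _ hc))
        fun a ha p hp => .inr (hGB f hf p (mem_viewTerms.2 ⟨_, a, ha, hp⟩))
      simp only [factMap, List.map_map] at this
      rwa [List.map_congr_left (f := e ∘ σ) (g := id) fun d hd => heσ d (hGA f hf d hd),
        List.map_id] at this
    · have hB : ℓ.2.eval (H (factMap σ ℓ.1)) ∈ B :=
        ⟨_, .inr (.inl ⟨litMap σ ℓ, List.mem_map_of_mem hℓ, rfl⟩), ℓ.2, hw ℓ hℓ, rfl⟩
      rw [hev _ _ (hw ℓ hℓ), hlow _ hB]
      exact hH.2 (litMap σ ℓ) (List.mem_map_of_mem hℓ)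
  rcases h H' hH' with ⟨g, hg, hacs, ht⟩ | ⟨ℓ, hℓ, hℓ'⟩
  · left
    have hgval : ∀ a ∈ Q.body, ∀ p ∈ a.args, p.eval g ∈ e '' (σ '' A ∪ B) := by
      intro a ha p hp
      obtain ⟨f, hf, b, hb, hab⟩ := hg a ha
      have hx : p.eval g ∈ (a.inst g).2 := List.mem_map.2 ⟨_, hp, rfl⟩
      rw [hab] at hx
      obtain ⟨p', hp', hpx⟩ := List.mem_map.1 hx
      have hp'' : p' ∈ viewTerms V := mem_viewTerms.2 ⟨_, b, hb, hp'⟩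
      rw [← hpx, hev f p' hp'']
      exact ⟨_, .inr (hGB f hf p' hp''), rfl⟩
    refine ⟨ρ ∘ g, fun a ha => ?_, fun b hb => ?_, ?_⟩
    · obtain ⟨f, hf, b, hb, hab⟩ := hg a ha
      refine ⟨factMap σ f, List.mem_map_of_mem hf, b, hb, ?_⟩
      rw [inst_comp fun c hc => hρK c (hKb.query (CQAC.const_mem_of_body ha hc)), hab]
      simp only [Atom.inst, List.map_map]
      congr 1
      refine List.map_congr_left fun p hp => ?_
      have hp' : p ∈ viewTerms V := mem_viewTerms.2 ⟨_, b, hb, hp⟩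
      rw [Function.comp_apply, hev f p hp', hρe _ (.inr (hGB f hf p hp'))]
    · refine holds_comp hρ (fun c hc => ⟨c, hKS (hKb.query hc), heK c (hKb.query hc)⟩)
        (fun c hc => hρK c (hKb.query hc)) hgval hb (hacs b hb)
    · rw [map_eval_comp fun c hc => hρK c (hKb.query (CQAC.const_mem_of_head hc)), ← ht]
      refine List.map_congr_left fun d hd => ?_
      conv_rhs => rw [← heσ d (htA d hd)]
      exact (hρe _ (.inl ⟨d, htA d hd, rfl⟩)).symm
  · right
    refine ⟨litMap σ ℓ, Option.mem_map_of_mem _ hℓ, ?_⟩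
    have hB : ℓ.2.eval (H (factMap σ ℓ.1)) ∈ B :=
      ⟨_, .inr (.inr ⟨litMap σ ℓ, Option.mem_map_of_mem _ hℓ, rfl⟩), ℓ.2, ho ℓ hℓ, rfl⟩
    rwa [hev _ _ (ho ℓ hℓ), hlow _ hB] at hℓ'

end

section

/-! ### The least fixpoint -/

/-- Iteration of a monotone operator on the subsets of a finite set stops after as many rounds as
the set has elements. -/
theorem iterate_empty_fixed {X : Type*} {F : Set X → Set X} (hF : Monotone F) {S : Set X}
    (hS : S.Finite) (hFS : ∀ D, F D ⊆ S) {N : ℕ} (hN : S.ncard ≤ N) :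
    F (F^[N] ∅) = F^[N] ∅ := by
  have hmono : ∀ i, F^[i] ∅ ⊆ F^[i + 1] ∅ := fun i =>
    hF.monotone_iterate_of_le_map (Set.empty_subset _) (Nat.le_succ i)
  have hsub : ∀ i, F^[i + 1] ∅ ⊆ S := fun i => by
    rw [Function.iterate_succ_apply']; exact hFS _
  have key : ∀ i, F^[i + 1] ∅ = F^[i] ∅ ∨ i + 1 ≤ (F^[i + 1] ∅).ncard := by
    intro i
    induction i with
    | zero =>
      rcases (F^[1] ∅).eq_empty_or_nonempty with h | h
      · exact .inl h
      · exact .inr ((Set.ncard_pos (hS.subset (hsub 0))).2 h)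
    | succ i ih =>
      rcases ih with h | h
      · left
        rw [Function.iterate_succ_apply', h, ← Function.iterate_succ_apply' F, h]
      · rcases (hmono (i + 1)).eq_or_ssubset with h' | h'
        · exact .inl h'.symm
        · exact .inr (h.trans_lt (Set.ncard_lt_ncard h' (hS.subset (hsub _))))
  rw [← Function.iterate_succ_apply' F]
  refine (key N).resolve_right fun h => ?_
  have := Set.ncard_le_ncard (hsub N) hS
  omega

variable {C : Type u} [LinearOrder C] {R : Type v} {n : ℕ} {Q : CQAC R C} {V : Fin n → CQAC R C}

/-- The certain answers are those that follow from the least set of literals closed under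
derivation. -/
theorem derives_iff_mem_certain [DenselyOrdered C] [Infinite C] (hQ : Q.IsClosedRSI1) {K : Set C}
    (hK : K.Finite) (hKb : IsBase Q V K) {I : Set (Fact (Fin n) C)} (hI : I.Finite)
    (hIK : ∀ f ∈ I, ∀ d ∈ f.2, d ∈ K) {t : List C} (htK : ∀ d ∈ t, d ∈ K) {N : ℕ}
    (hN : {ℓ : Lit n C | ℓ.1 ∈ I ∧ ℓ.2 ∈ viewTerms V}.ncard ≤ N) :
    Derives Q V t I ((deriveStep Q V t I)^[N] ∅) none ↔ t ∈ certain Q V I := by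
  have hfin : {ℓ : Lit n C | ℓ.1 ∈ I ∧ ℓ.2 ∈ viewTerms V}.Finite :=
    hI.prod (List.finite_toSet (viewTerms V))
  have hfix := iterate_empty_fixed (deriveStep_mono (Q := Q) (V := V) t I) hfin
    (fun _ => deriveStep_subset) hN
  rw [mem_certain_iff Q V hI]
  constructor
  · intro h H hH
    by_contra ht
    have hlow : ∀ i, ∀ ℓ ∈ (deriveStep Q V t I)^[i] ∅, Low Q (ℓ.2.eval (H ℓ.1)) := by
      intro i
      induction i with
      | zero => exact fun ℓ hℓ => hℓ.elim
      | succ i ih =>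
        intro ℓ hℓ
        rw [Function.iterate_succ_apply'] at hℓ
        obtain ⟨ℓ', hℓ', h⟩ := hℓ.2.2.sound hH ht ih
        obtain rfl := Option.some.inj hℓ'
        exact h
    obtain ⟨ℓ, hℓ, -⟩ := h.sound hH ht (hlow N)
    cases hℓ
  · intro h
    by_contra hgoal
    obtain ⟨H, hH, ht⟩ := exists_not_ans hQ hK hKb hI hIK htK
      (by rw [← hfix]; exact deriveStep_subset) hfix.subset hgoal
    exact ht (h H hH)

/-! ### Encodings -/

section Encoding

omit [LinearOrder C]

/-- A term written as a tree: a variable in unary, or a constant. -/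
def encodeTerm : Term C → Tree C
  | .var x => encodeList (List.replicate x .nil)
  | .const c => .atom c

/-- A literal written as a tree. -/
def encodeLit (ℓ : Lit n C) : Tree C := .cons (encodeFact ℓ.1) (encodeTerm ℓ.2)

/-- The conclusion of a rule written as a tree. -/
def encodeGoal : Option (Lit n C) → Tree C
  | none => .nil
  | some ℓ => encodeLit ℓ

/-- An entailment problem written as a tree. -/
def encodeRule (t : List C) (G : List (Fact (Fin n) C)) (w : List (Lit n C))
    (o : Option (Lit n C)) : Tree C :=
  .cons (encodeTuple t) (.cons (encodeInstance G)
    (.cons (encodeList (w.map encodeLit)) (encodeGoal o)))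

theorem encodeList_injective : Function.Injective (encodeList : List (Tree C) → Tree C) :=
  Function.LeftInverse.injective toList_encodeList

theorem encodeTuple_injective : Function.Injective (encodeTuple : List C → Tree C) :=
  encodeList_injective.comp (List.map_injective_iff.2 fun _ _ h => Tree.atom.inj h)

theorem encodeFact_injective : Function.Injective (encodeFact : Fact (Fin n) C → Tree C) := by
  rintro ⟨i, d⟩ ⟨i', d'⟩ h
  obtain ⟨h₁, h₂⟩ := Tree.cons.inj h
  have h₃ := congrArg List.length (encodeList_injective h₁)
  simp only [List.length_replicate] at h₃
  exact Prod.ext (Fin.ext h₃) (encodeTuple_injective h₂)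

theorem encodeTerm_injective : Function.Injective (encodeTerm : Term C → Tree C) := by
  rintro (x | c) (y | d) h
  · have := congrArg List.length (encodeList_injective h)
    simp only [List.length_replicate] at this
    rw [this]
  · cases x <;> cases h
  · cases y <;> cases h
  · rw [Tree.atom.inj h]

theorem encodeLit_injective : Function.Injective (encodeLit : Lit n C → Tree C) := by
  intro ℓ ℓ' h
  obtain ⟨h₁, h₂⟩ := Tree.cons.inj h
  exact Prod.ext (encodeFact_injective h₁) (encodeTerm_injective h₂)

theorem encodeRule_inj {t t' : List C} {G G' : List (Fact (Fin n) C)} {w w' : List (Lit n C)}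
    {o o' : Option (Lit n C)} (h : encodeRule t G w o = encodeRule t' G' w' o') :
    t = t' ∧ G = G' ∧ w = w' ∧ o = o' := by
  obtain ⟨h₁, h⟩ := Tree.cons.inj h
  obtain ⟨h₂, h⟩ := Tree.cons.inj h
  obtain ⟨h₃, h₄⟩ := Tree.cons.inj h
  refine ⟨encodeTuple_injective h₁,
    List.map_injective_iff.2 encodeFact_injective (encodeList_injective h₂),
    List.map_injective_iff.2 encodeLit_injective (encodeList_injective h₃), ?_⟩
  cases o <;> cases o'
  · rfl
  · cases h₄
  · cases h₄
  · rw [encodeLit_injective h₄]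

theorem map_encodeList (σ : C → C) (l : List (Tree C)) :
    (encodeList l).map σ = encodeList (l.map (Tree.map σ)) := by
  induction l with
  | nil => rfl
  | cons a l ih => simp [encodeList, Tree.map, ih]

theorem map_encodeTuple (σ : C → C) (t : List C) :
    (encodeTuple t).map σ = encodeTuple (t.map σ) := by
  simp [encodeTuple, map_encodeList, Function.comp_def, Tree.map]

theorem map_encodeFact (σ : C → C) (f : Fact (Fin n) C) :
    (encodeFact f).map σ = encodeFact (factMap σ f) := by
  simp [encodeFact, Tree.map, map_encodeTuple, map_encodeList, factMap]

theorem map_encodeLit {σ : C → C} {ℓ : Lit n C} (h : ∀ c, ℓ.2 = .const c → σ c = c) :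
    (encodeLit ℓ).map σ = encodeLit (litMap σ ℓ) := by
  rw [encodeLit, Tree.map, map_encodeFact, encodeLit, litMap]
  cases hp : ℓ.2 with
  | var x => simp [encodeTerm, map_encodeList, Tree.map]
  | const c => rw [encodeTerm, Tree.map, h c hp]

theorem map_encodeRule {σ : C → C} {t : List C} {G : List (Fact (Fin n) C)} {w : List (Lit n C)}
    {o : Option (Lit n C)} (hw : ∀ ℓ ∈ w, ∀ c, ℓ.2 = .const c → σ c = c)
    (ho : ∀ ℓ ∈ o, ∀ c, ℓ.2 = .const c → σ c = c) :
    (encodeRule t G w o).map σ =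
      encodeRule (t.map σ) (G.map (factMap σ)) (w.map (litMap σ)) (o.map (litMap σ)) := by
  simp only [encodeRule, Tree.map, map_encodeTuple, encodeInstance, map_encodeList, List.map_map]
  have h₁ : (Tree.map σ ∘ encodeFact : Fact (Fin n) C → Tree C) = encodeFact ∘ factMap σ :=
    funext (map_encodeFact σ)
  have h₂ : w.map (Tree.map σ ∘ encodeLit) = w.map (encodeLit ∘ litMap σ) :=
    List.map_congr_left fun ℓ hℓ => map_encodeLit (hw ℓ hℓ)
  rw [h₁, h₂]
  congr 3
  · cases o with
    | none => rfl
    | some ℓ => exact map_encodeLit (ho ℓ rfl)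

theorem Tree.finite_atoms (t : Tree C) : t.atoms.Finite := by
  induction t with
  | nil => exact Set.finite_empty
  | atom c => exact Set.finite_singleton c
  | cons l r hl hr => exact hl.union hr

theorem atoms_subset_encodeList {l : List (Tree C)} {a : Tree C} (h : a ∈ l) :
    a.atoms ⊆ (encodeList l).atoms := by
  induction l with
  | nil => cases h
  | cons b l ih =>
    rcases List.mem_cons.1 h with rfl | h
    · exact Set.subset_union_left
    · exact (ih h).trans Set.subset_union_right

theorem mem_atoms_encodeTuple {t : List C} {d : C} (h : d ∈ t) : d ∈ (encodeTuple t).atoms :=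
  atoms_subset_encodeList (List.mem_map_of_mem h) rfl

theorem mem_atoms_encodeInstance {G : List (Fact (Fin n) C)} {f : Fact (Fin n) C} (hf : f ∈ G)
    {d : C} (h : d ∈ f.2) : d ∈ (encodeInstance G).atoms :=
  atoms_subset_encodeList (List.mem_map_of_mem hf) (.inr (mem_atoms_encodeTuple h))

theorem depth_encodeList_le {l : List (Tree C)} {B : ℕ} (h : ∀ a ∈ l, a.depth ≤ B) :
    (encodeList l).depth ≤ l.length + B := by
  induction l with
  | nil => simp [encodeList, Tree.depth]
  | cons a l ih =>
    have h₁ := h a List.mem_cons_self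
    have h₂ := ih fun b hb => h b (List.mem_cons_of_mem _ hb)
    simp only [encodeList, Tree.depth, List.length_cons]
    omega

theorem depth_encodeTuple_le (t : List C) : (encodeTuple t).depth ≤ t.length := by
  have := depth_encodeList_le (l := t.map Tree.atom) (B := 0) (by simp [Tree.depth])
  rwa [List.length_map, add_zero] at this

theorem depth_encodeFact_le (f : Fact (Fin n) C) : (encodeFact f).depth ≤ n + f.2.length + 1 := by
  have h₁ := depth_encodeList_le (l := List.replicate f.1 (.nil : Tree C)) (B := 0)
    (by simp [Tree.depth])
  have h₂ := depth_encodeTuple_le f.2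
  have h₃ := f.1.2
  simp only [List.length_replicate] at h₁
  simp only [encodeFact, Tree.depth]
  omega

end Encoding

theorem exists_list_bound {X : Type*} (l : List X) (g : X → ℕ) : ∃ N, ∀ x ∈ l, g x ≤ N :=
  ⟨(l.map g).sum, fun _ hx => List.le_sum_of_mem (List.mem_map_of_mem hx)⟩

variable (Q V) in
/-- Entailment problems of bounded size have bounded depth as trees. -/
theorem exists_depth_encodeRule_le (r : ℕ) : ∃ N, ∀ (t : List C) (G : List (Fact (Fin n) C))
    (w : List (Lit n C)) (o : Option (Lit n C)), t.length ≤ r →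
    G.length ≤ numFacts Q → w.length ≤ numLits Q V →
    (∀ f ∈ G, f.2.length = (V f.1).head.length) →
    (∀ ℓ ∈ w, ℓ.1.2.length = (V ℓ.1.1).head.length ∧ ℓ.2 ∈ viewTerms V) →
    (∀ ℓ ∈ o, ℓ.1.2.length = (V ℓ.1.1).head.length ∧ ℓ.2 ∈ viewTerms V) →
    (encodeRule t G w o).depth ≤ N := by
  obtain ⟨M, hM⟩ := exists_list_bound (List.finRange n) fun i => (V i).head.length
  obtain ⟨M', hM'⟩ := exists_list_bound (viewTerms V) fun p => (encodeTerm p).depth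
  have hfact : ∀ f : Fact (Fin n) C, f.2.length = (V f.1).head.length →
      (encodeFact f).depth ≤ n + M + 1 := fun f hf => by
    have h₁ := depth_encodeFact_le f
    have h₂ := hM f.1 (List.mem_finRange _)
    omega
  have hlit : ∀ ℓ : Lit n C, ℓ.1.2.length = (V ℓ.1.1).head.length ∧ ℓ.2 ∈ viewTerms V →
      (encodeLit ℓ).depth ≤ n + M + M' + 2 := fun ℓ hℓ => by
    have h₁ := hfact ℓ.1 hℓ.1
    have h₂ := hM' ℓ.2 hℓ.2
    simp only [encodeLit, Tree.depth]
    omega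
  refine ⟨r + numFacts Q + numLits Q V + (n + M + M' + 2) + 3,
    fun t G w o ht hG hw hGa hwa hoa => ?_⟩
  have h₁ := depth_encodeTuple_le t
  have h₂ : (encodeInstance G).depth ≤ G.length + (n + M + 1) := by
    have := depth_encodeList_le (l := G.map encodeFact) (B := n + M + 1) (by
      simp only [List.mem_map, forall_exists_index, and_imp, forall_apply_eq_imp_iff₂]
      exact fun f hf => hfact f (hGa f hf))
    rwa [List.length_map] at this
  have h₃ : (encodeList (w.map encodeLit)).depth ≤ w.length + (n + M + M' + 2) := by
    have := depth_encodeList_le (l := w.map encodeLit) (B := n + M + M' + 2) (by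
      simp only [List.mem_map, forall_exists_index, and_imp, forall_apply_eq_imp_iff₂]
      exact fun ℓ hℓ => hlit ℓ (hwa ℓ hℓ))
    rwa [List.length_map] at this
  have h₄ : (encodeGoal o).depth ≤ n + M + M' + 2 := by
    cases o with
    | none => simp [encodeGoal, Tree.depth]
    | some ℓ => exact hlit ℓ (hoa ℓ rfl)
  simp only [encodeRule, Tree.depth]
  omega

end

section

variable {C : Type u} [LinearOrder C] {R : Type v} {n : ℕ} {Q : CQAC R C} {V : Fin n → CQAC R C}
  {len : C → ℕ}

/-! ### The algorithm -/

variable (Q V) in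
/-- Entailment is decided in polynomial time on the problems of bounded size. -/
theorem exists_entails_decision [DenselyOrdered C] [Infinite C] {K : Set C} (hK : K.Finite)
    (hKb : IsBase Q V K) (r : ℕ) :
    ∃ e, PolyTime len e ∧ ∀ (t : List C) (G : List (Fact (Fin n) C))
    (w : List (Lit n C)) (o : Option (Lit n C)), t.length ≤ r →
    G.length ≤ numFacts Q → w.length ≤ numLits Q V →
    (∀ f ∈ G, f.2.length = (V f.1).head.length) →
    (∀ ℓ ∈ w, ℓ.1.2.length = (V ℓ.1.1).head.length ∧ ℓ.2 ∈ viewTerms V) →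
    (∀ ℓ ∈ o, ℓ.1.2.length = (V ℓ.1.1).head.length ∧ ℓ.2 ∈ viewTerms V) →
    ((e (encodeRule t G w o)).IsCons ↔ Entails Q V t G w o) := by
  obtain ⟨N, hN⟩ := exists_depth_encodeRule_le Q V r
  obtain ⟨e, he, h⟩ := exists_decision (len := len) hK N
    (fun x => ∃ (t : List C) (G : List (Fact (Fin n) C)) (w : List (Lit n C))
      (o : Option (Lit n C)), x = encodeRule t G w o ∧ (∀ ℓ ∈ w, ℓ.2 ∈ viewTerms V) ∧
      (∀ ℓ ∈ o, ℓ.2 ∈ viewTerms V) ∧ Entails Q V t G w o) (by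
    rintro _ σ hσ hσK ⟨t, G, w, o, rfl, hw, ho, h⟩
    refine ⟨t.map σ, G.map (factMap σ), w.map (litMap σ), o.map (litMap σ), ?_, ?_, ?_, ?_⟩
    · exact map_encodeRule (fun ℓ hℓ c hc => hσK c (hKb.const_mem (hc ▸ hw ℓ hℓ)))
        fun ℓ hℓ c hc => hσK c (hKb.const_mem (hc ▸ ho ℓ hℓ))
    · intro ℓ hℓ
      obtain ⟨ℓ', hℓ', rfl⟩ := List.mem_map.1 hℓ
      exact hw ℓ' hℓ'
    · intro ℓ hℓ
      obtain ⟨ℓ', hℓ', rfl⟩ := Option.map_eq_some_iff.1 hℓ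
      exact ho ℓ' hℓ'
    · exact h.map hKb (hK.union (Tree.finite_atoms _)) Set.subset_union_left hσ hσK
        (fun d hd => .inr (.inl (mem_atoms_encodeTuple hd)))
        (fun f hf d hd => .inr (.inr (.inl (mem_atoms_encodeInstance hf hd)))) hw ho)
  refine ⟨e, he, fun t G w o ht hG hw hGa hwa hoa => ?_⟩
  rw [h _ (hN t G w o ht hG hw hGa hwa hoa)]
  constructor
  · rintro ⟨t', G', w', o', heq, -, -, h⟩
    obtain ⟨rfl, rfl, rfl, rfl⟩ := encodeRule_inj heq
    exact h
  · exact fun h => ⟨t, G, w, o, rfl, fun ℓ hℓ => (hwa ℓ hℓ).2, fun ℓ hℓ => (hoa ℓ hℓ).2, h⟩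

/-- The items of the tree `a`, read as a list, are the encodings of the literals in `D`. -/
def Represents (a : Tree C) (D : Set (Lit n C)) : Prop :=
  ∀ y, y ∈ a.toList ↔ ∃ ℓ ∈ D, y = encodeLit ℓ

omit [LinearOrder C] in
theorem exists_eq_map {X : Type*} {g : X → Tree C} {P : X → Prop} {l : List (Tree C)}
    (h : ∀ y ∈ l, ∃ x, P x ∧ y = g x) : ∃ m : List X, (∀ x ∈ m, P x) ∧ l = m.map g := by
  induction l with
  | nil => exact ⟨[], by simp, rfl⟩
  | cons y l ih =>
    obtain ⟨x, hx, rfl⟩ := h y List.mem_cons_self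
    obtain ⟨m, hm, rfl⟩ := ih fun y hy => h y (List.mem_cons_of_mem _ hy)
    exact ⟨x :: m, by simpa [hx] using hm, rfl⟩

variable (Q V) in
/-- Derivability is decided in polynomial time. The argument of the algorithm consists of the
conclusion, a listing of the literals derived so far, the candidate answer and the instance. -/
theorem exists_derives_decision [DenselyOrdered C] [Infinite C] {K : Set C} (hK : K.Finite)
    (hKb : IsBase Q V K) (r : ℕ) :
    ∃ e, PolyTime len e ∧ ∀ (t : List C) (L : List (Fact (Fin n) C)) (a : Tree C)
    (D : Set (Lit n C)) (o : Option (Lit n C)), t.length ≤ r →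
    (∀ f ∈ L, f.2.length = (V f.1).head.length) →
    D ⊆ {ℓ | ℓ.1 ∈ L ∧ ℓ.2 ∈ viewTerms V} → Represents a D →
    (∀ ℓ ∈ o, ℓ.1 ∈ L ∧ ℓ.2 ∈ viewTerms V) →
    ((e (.cons (encodeGoal o) (.cons a (.cons (encodeTuple t) (encodeInstance L))))).IsCons ↔
      Derives Q V t {f | f ∈ L} D o) := by
  obtain ⟨d, hd, hd'⟩ := exists_entails_decision (len := len) Q V hK hKb r
  have hr : PolyTime len (fun x : Tree C => x.right) := .right
  have hrr : PolyTime len (fun x : Tree C => x.right.right) := hr.comp .right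
  have hrrr : PolyTime len (fun x : Tree C => x.right.right.right) := hrr.comp .right
  obtain ⟨facts, hfacts, hfacts'⟩ := hrrr.exists_tuples (numFacts Q)
  obtain ⟨lits, hlits, hlits'⟩ := (PolyTime.left.comp hrr).exists_tuples (numLits Q V)
  -- the argument is `(w, (G, (o, (a, (t, L)))))` here
  obtain ⟨e₁, he₁, he₁'⟩ := hlits.exists_any (c := fun y => d (.cons y.right.right.right.right.left
    (.cons y.right.left (.cons y.left y.right.right.left)))) (hd.comp
      ((PolyTime.left.comp (hrrr.comp .right)).cons ((PolyTime.left.comp .right).cons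
        (PolyTime.left.cons (PolyTime.left.comp hrr)))))
  obtain ⟨e₂, he₂, he₂'⟩ := hfacts.exists_any he₁
  refine ⟨e₂, he₂, fun t L a D o ht hL hD ha ho => ?_⟩
  have ho' : ∀ ℓ ∈ o, ℓ.1.2.length = (V ℓ.1.1).head.length ∧ ℓ.2 ∈ viewTerms V :=
    fun ℓ hℓ => ⟨hL _ (ho ℓ hℓ).1, (ho ℓ hℓ).2⟩
  have hD' : ∀ ℓ ∈ D, ℓ.1.2.length = (V ℓ.1.1).head.length ∧ ℓ.2 ∈ viewTerms V :=
    fun ℓ hℓ => ⟨hL _ (hD hℓ).1, (hD hℓ).2⟩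
  rw [he₂']
  simp only [hfacts', he₁', hlits', Tree.left, Tree.right, encodeInstance, toList_encodeList]
  constructor
  · rintro ⟨_, ⟨G', hG, hGL, rfl⟩, _, ⟨w', hw, hwD, rfl⟩, h⟩
    obtain ⟨G, hG', rfl⟩ := exists_eq_map (g := encodeFact) (P := (· ∈ L)) fun y hy => by
      obtain ⟨f, hf, rfl⟩ := List.mem_map.1 (hGL y hy)
      exact ⟨f, hf, rfl⟩
    obtain ⟨w, hw', rfl⟩ := exists_eq_map (g := encodeLit) (P := (· ∈ D)) fun y hy =>
      (ha y).1 (hwD y hy)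
    rw [List.length_map] at hG hw
    exact ⟨G, hG, hG', w, hw, hw', (hd' t G w o ht hG hw (fun f hf => hL f (hG' f hf))
      (fun ℓ hℓ => hD' ℓ (hw' ℓ hℓ)) ho').1 h⟩
  · rintro ⟨G, hG, hGL, w, hw, hwD, h⟩
    refine ⟨_, ⟨G.map encodeFact, by simpa using hG, fun y hy => ?_, rfl⟩,
      _, ⟨w.map encodeLit, by simpa using hw, fun y hy => ?_, rfl⟩,
      (hd' t G w o ht hG hw (fun f hf => hL f (hGL f hf)) (fun ℓ hℓ => hD' ℓ (hwD ℓ hℓ)) ho').2 h⟩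
    · obtain ⟨f, hf, rfl⟩ := List.mem_map.1 hy
      exact List.mem_map_of_mem (hGL f hf)
    · obtain ⟨ℓ, hℓ, rfl⟩ := List.mem_map.1 hy
      exact (ha _).2 ⟨ℓ, hwD ℓ hℓ, rfl⟩

omit [LinearOrder C] in
theorem size_encodeList_filter_le (p : Tree C → Bool) (l : List (Tree C)) :
    (encodeList (l.filter p).reverse).size len ≤ (encodeList l).size len := by
  simp only [size_encodeList, List.map_reverse, List.sum_reverse]
  have := (List.filter_sublist (p := p) (l := l)).map fun t : Tree C => 1 + t.size len
  have := this.sum_le_sum (fun _ _ => Nat.zero_le _)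
  omega

variable (Q V) in
/-- Membership of a tuple in the certain answers is decided in polynomial time. The argument of the
algorithm consists of the tuple and the instance. -/
theorem exists_certain_decision [DenselyOrdered C] [Infinite C] (hQ : Q.IsClosedRSI1) {K : Set C}
    (hK : K.Finite) (hKb : IsBase Q V K) (r : ℕ) :
    ∃ e, PolyTime len e ∧ ∀ (t : List C) (L : List (Fact (Fin n) C)), t.length ≤ r →
    (∀ f ∈ L, f.2.length = (V f.1).head.length) →
    (∀ d ∈ t, d ∈ K ∨ ∃ f ∈ L, d ∈ f.2) →
    ((e (.cons (encodeTuple t) (encodeInstance L))).IsCons ↔ t ∈ certain Q V {f | f ∈ L}) := by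
  classical
  obtain ⟨d, hd, hd'⟩ := exists_derives_decision (len := len) Q V hK hKb r
  -- all literals about the facts of the instance
  let labels : Tree C := encodeList ((viewTerms V).map encodeTerm)
  let lits : Tree C → Tree C := fun z => encodeList (z.right.toList.flatMap fun f =>
    (encodeList (labels.toList.flatMap fun p =>
      (Tree.cons (.cons f p) .nil).toList).reverse).toList).reverse
  have hlits : PolyTime len lits :=
    (PolyTime.right (len := len)).flatMap (f := fun y => encodeList (labels.toList.flatMap fun p =>
      (Tree.cons (.cons y.left p) .nil).toList).reverse)
      ((PolyTime.const labels).flatMap (f := fun y => .cons (.cons y.right.left y.left) .nil)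
        (((PolyTime.left.comp .right).cons .left).cons .nil))
  have hlits' : ∀ (t : List C) (L : List (Fact (Fin n) C)) (y : Tree C),
      y ∈ (lits (.cons (encodeTuple t) (encodeInstance L))).toList ↔
        ∃ ℓ : Lit n C, (ℓ.1 ∈ L ∧ ℓ.2 ∈ viewTerms V) ∧ y = encodeLit ℓ := by
    intro t L y
    simp only [lits, labels, encodeInstance, Tree.right, toList_encodeList, Tree.toList,
      List.mem_reverse, List.mem_flatMap, List.mem_map, List.mem_singleton, encodeLit, Prod.exists]
    constructor
    · rintro ⟨_, ⟨i, l, hf, rfl⟩, _, ⟨p, hp, rfl⟩, rfl⟩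
      exact ⟨i, l, p, ⟨hf, hp⟩, rfl⟩
    · rintro ⟨i, l, p, ⟨hf, hp⟩, rfl⟩
      exact ⟨_, ⟨i, l, hf, rfl⟩, _, ⟨p, hp, rfl⟩, rfl⟩
  obtain ⟨B, hB⟩ := hlits.size_le
  -- one round of derivation, on `(a, (t, L))`
  let step : Tree C → Tree C := fun x =>
    encodeList ((lits x.right).toList.filter fun it => (d (.cons it x)).IsCons).reverse
  have hstep : PolyTime len step := (hlits.comp .right).filter hd
  have hstepB : ∀ a z, (step (.cons a z)).size len ≤ B.eval (z.size len) := fun a z =>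
    ((size_encodeList_filter_le _ _).trans (size_encodeList_toList_le _)).trans (hB z)
  have hstep' : ∀ (t : List C) (L : List (Fact (Fin n) C)) (a : Tree C) (D : Set (Lit n C)),
      t.length ≤ r → (∀ f ∈ L, f.2.length = (V f.1).head.length) →
      D ⊆ {ℓ | ℓ.1 ∈ L ∧ ℓ.2 ∈ viewTerms V} → Represents a D →
      Represents (step (.cons a (.cons (encodeTuple t) (encodeInstance L))))
        (deriveStep Q V t {f | f ∈ L} D) := by
    intro t L a D ht hL hD ha y
    simp only [step, toList_encodeList, List.mem_reverse, List.mem_filter, decide_eq_true_eq]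
    rw [Tree.right, hlits']
    constructor
    · rintro ⟨⟨ℓ, hℓ, rfl⟩, h⟩
      exact ⟨ℓ, ⟨hℓ.1, hℓ.2, (hd' t L a D (some ℓ) ht hL hD ha
        fun _ h => by obtain rfl := Option.some.inj h; exact hℓ).1 h⟩, rfl⟩
    · rintro ⟨ℓ, ⟨h₁, h₂, h⟩, rfl⟩
      exact ⟨⟨ℓ, ⟨h₁, h₂⟩, rfl⟩, (hd' t L a D (some ℓ) ht hL hD ha
        fun _ h => by obtain rfl := Option.some.inj h; exact ⟨h₁, h₂⟩).2 h⟩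
  have hiter := hlits.iterate hstep B hstepB
  refine ⟨_, hd.comp (PolyTime.nil.cons (hiter.cons .id)), fun t L ht hL htK => ?_⟩
  set z : Tree C := .cons (encodeTuple t) (encodeInstance L) with hz
  have hrep : ∀ i, Represents ((fun acc => step (.cons acc z))^[i] .nil)
      ((deriveStep Q V t {f | f ∈ L})^[i] ∅) ∧
      (deriveStep Q V t {f | f ∈ L})^[i] ∅ ⊆ {ℓ | ℓ.1 ∈ L ∧ ℓ.2 ∈ viewTerms V} := by
    intro i
    induction i with
    | zero => exact ⟨fun y => by simp [Tree.toList], Set.empty_subset _⟩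
    | succ i ih =>
      rw [Function.iterate_succ_apply', Function.iterate_succ_apply']
      exact ⟨hstep' t L _ _ ht hL ih.2 ih.1, deriveStep_subset⟩
  have hN : {ℓ : Lit n C | ℓ.1 ∈ {f | f ∈ L} ∧ ℓ.2 ∈ viewTerms V}.ncard ≤
      (lits z).toList.length := by
    rw [← Set.ncard_image_of_injective _ encodeLit_injective]
    refine le_trans (Set.ncard_le_ncard (t := ((lits z).toList.toFinset : Set (Tree C))) ?_
      (Finset.finite_toSet _)) ?_
    · rintro _ ⟨ℓ, hℓ, rfl⟩
      rw [Finset.mem_coe, List.mem_toFinset]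
      exact (hlits' t L _).2 ⟨ℓ, hℓ, rfl⟩
    · rw [Set.ncard_coe_finset]
      exact List.toFinset_card_le _
  have hadom : {c | ∃ f ∈ L, c ∈ f.2}.Finite :=
    ((List.finite_toSet L).biUnion fun f _ => List.finite_toSet f.2).subset
      fun c ⟨f, hf, hc⟩ => Set.mem_biUnion (x := f) hf hc
  rw [← derives_iff_mem_certain hQ (hK.union hadom) (hKb.mono Set.subset_union_left)
    (List.finite_toSet L) (fun f hf c hc => .inr ⟨f, hf, hc⟩) htK hN]
  exact hd' t L _ _ none ht hL (hrep _).2 (hrep _).1 (by simp)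

/-- The tuples over the constants of the instance and of `K`, up to a given length, are listed in
polynomial time. -/
theorem exists_candidates {K : Set C} (hK : K.Finite) (r : ℕ) :
    ∃ e, PolyTime len e ∧ ∀ (L : List (Fact (Fin n) C)) (y : Tree C),
      y ∈ (e (encodeInstance L)).toList ↔
        ∃ t : List C, (t.length ≤ r ∧ ∀ d ∈ t, d ∈ K ∨ ∃ f ∈ L, d ∈ f.2) ∧ y = encodeTuple t := by
  let consts : Tree C := encodeList (hK.toFinset.toList.map .atom)
  let args : Tree C → Tree C := fun x =>
    encodeList (x.toList.flatMap fun f => f.right.toList).reverse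
  have hargs : PolyTime len args :=
    PolyTime.id.flatMap (f := fun y => y.left.right) (PolyTime.right.comp .left)
  obtain ⟨e, he, he'⟩ := ((PolyTime.const consts).revAppend hargs).exists_tuples r
  refine ⟨e, he, fun L y => ?_⟩
  have hmem : ∀ a, a ∈ (consts.revAppend (args (encodeInstance L))).toList ↔
      ∃ c, (c ∈ K ∨ ∃ f ∈ L, c ∈ f.2) ∧ a = .atom c := by
    intro a
    simp only [args, consts, revAppend_encodeList, toList_encodeList, List.mem_append,
      List.mem_reverse, List.mem_map, Finset.mem_toList, Set.Finite.mem_toFinset, encodeInstance,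
      List.mem_flatMap]
    constructor
    · rintro (⟨c, hc, rfl⟩ | ⟨_, ⟨f, hf, rfl⟩, ha⟩)
      · exact ⟨c, .inl hc, rfl⟩
      · simp only [encodeFact, Tree.right, encodeTuple, toList_encodeList, List.mem_map] at ha
        obtain ⟨c, hc, rfl⟩ := ha
        exact ⟨c, .inr ⟨f, hf, hc⟩, rfl⟩
    · rintro ⟨c, hc | ⟨f, hf, hc⟩, rfl⟩
      · exact .inl ⟨c, hc, rfl⟩
      · refine .inr ⟨_, ⟨f, hf, rfl⟩, ?_⟩
        simp only [encodeFact, Tree.right, encodeTuple, toList_encodeList]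
        exact List.mem_map_of_mem hc
  rw [he']
  constructor
  · rintro ⟨w, hw, hwm, rfl⟩
    obtain ⟨t, ht, rfl⟩ := exists_eq_map fun a ha => (hmem a).1 (hwm a ha)
    exact ⟨t, ⟨by simpa using hw, ht⟩, rfl⟩
  · rintro ⟨t, ⟨ht, htm⟩, rfl⟩
    refine ⟨t.map .atom, by simpa using ht, fun a ha => ?_, rfl⟩
    obtain ⟨c, hc, rfl⟩ := List.mem_map.1 ha
    exact (hmem _).2 ⟨c, htm c hc, rfl⟩

end

end CertainAnswers

theorem mainTheorem5 {C : Type*} [LinearOrder C] [DenselyOrdered C] [Infinite C] {R : Type*}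
    (len : C → ℕ) {n : ℕ} (Q : CertainAnswers.CQAC R C) (hQ : Q.IsClosedRSI1)
    (V : Fin n → CertainAnswers.CQAC R C) :
    ∃ (p : CertainAnswers.Prog C) (P : Polynomial ℕ),
      ∀ L : List (CertainAnswers.Fact (Fin n) C),
        (∃ D : CertainAnswers.Database R C, {f | f ∈ L} ⊆ CertainAnswers.viewOutput V D) →
        ∃ (A : List (List C)) (T : ℕ),
          CertainAnswers.Computes len p (CertainAnswers.encodeInstance L)
            (CertainAnswers.encodeAnswers A) T ∧
          T ≤ P.eval ((CertainAnswers.encodeInstance L).size len) ∧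
          {t | t ∈ A} = CertainAnswers.certain Q V {f | f ∈ L} := by
  classical
  open CertainAnswers in
  obtain ⟨K, hK, hKb⟩ := exists_isBase Q V
  obtain ⟨cand, hcand, hcand'⟩ := exists_candidates (len := len) (n := n) hK Q.head.length
  obtain ⟨e, he, he'⟩ := exists_certain_decision (len := len) Q V hQ hK hKb Q.head.length
  obtain ⟨p, P, hp⟩ := hcand.filter he
  refine ⟨p, P, fun L ⟨D, hD⟩ => ?_⟩
  have hsol : ∀ f : Fact (Fin n) C, ∃ h : ℕ → C, f ∈ L → Solves V f h := by
    intro f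
    by_cases hf : f ∈ L
    · obtain ⟨h, -, h₂, h₃⟩ := hD hf
      exact ⟨h, fun _ => ⟨h₃, h₂⟩⟩
    · obtain ⟨h, -⟩ := Q.consistent
      exact ⟨h, fun hf' => absurd hf' hf⟩
  choose H hH using hsol
  have hL : ∀ f ∈ L, f.2.length = (V f.1).head.length := fun f hf => by
    rw [(hH f hf).1, List.length_map]
  obtain ⟨A, hA, hA'⟩ := exists_eq_map (g := encodeTuple)
    (P := fun t => t ∈ certain Q V {f | f ∈ L})
    (l := ((cand (encodeInstance L)).toList.filter
      fun it => (e (.cons it (encodeInstance L))).IsCons).reverse) fun y hy => by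
    rw [List.mem_reverse, List.mem_filter, hcand'] at hy
    obtain ⟨⟨t, ⟨ht, htK⟩, rfl⟩, h⟩ := hy
    exact ⟨t, (he' t L ht hL htK).1 (by simpa using h), rfl⟩
  obtain ⟨T, s', hrun, hs', hT⟩ :=
    hp (Function.update (fun _ => .nil) 0 (encodeInstance L))
  rw [Function.update_self] at hs' hT
  refine ⟨A, T, ⟨s', hrun, ?_⟩, hT, Set.Subset.antisymm hA fun t ht => ?_⟩
  · rw [hs', encodeAnswers, ← hA']
  · have hadom : {c | ∃ f ∈ L, c ∈ f.2}.Finite :=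
      ((List.finite_toSet L).biUnion fun f _ => List.finite_toSet f.2).subset
        fun c ⟨f, hf, hc⟩ => Set.mem_biUnion (x := f) hf hc
    obtain ⟨hlen, htK⟩ := mem_of_mem_certain (hK.union hadom) (hKb.mono Set.subset_union_left)
      (List.finite_toSet L) (fun f hf c hc => .inr ⟨f, hf, hc⟩) hH ht
    have hmem : encodeTuple t ∈ A.map encodeTuple := by
      rw [← hA', List.mem_reverse, List.mem_filter, hcand']
      exact ⟨⟨t, ⟨hlen.le, htK⟩, rfl⟩, by simpa using (he' t L hlen.le hL htK).2 ht⟩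
    obtain ⟨t', ht', h⟩ := List.mem_map.1 hmem
    rwa [encodeTuple_injective h] at ht'
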